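/- Let $G(n,p)$ be the random graph on $n$ labelled vertices in which each of the $\binom n2$ potential edges is present independently with probability $p$, and let $k=k(n)$ be $\ln n$ rounded to an integer, i.e. any integers $k(n)\ge 0$ with $|k(n)-\ln n|<1$. A dominating set of a graph is a set $S$ of vertices such that every vertex lies in $S$ or is adjacent to a vertex of $S$. For a set $U$ of vertices of a graph $G$, a symmetry mapping outside $U$ chooses four distinct vertices $u,v,z,w\notin U$ among which $uv$ and $zw$ are the only edges of $G$, and replaces these two edges by $uz$ and $vw$; it leaves the induced subgraph $G[U]$ unchanged. Theorem. For every constant $0<\delta<1$ there is $\rho>0$, depending only on $\delta$, such that the following holds. For every $k$ as above there are edge probabilities $p=p(n)\in[0,1]$ for which the expected number of dominating sets of size $k$ in $G(n,p)$ tends to $\delta$ as $n\to\infty$, and for every such $p$: (a) The dominating set problem for $G(n,p)$ is irreducible: there is no constant $0<c<1$ with a choice of vertex sets $U_n$ (fixed independently of the random graph), $|U_n|\le n^c$, such that with probability tending to $1$ the induced subgraph $H=G[U_n]$ contains a dominating set of size $k$ if and only if $G$ does. (b) For all constants $0<c<1$ and $\varepsilon>0$, for all sufficiently large $n$ and for every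 set $U$ of at most $n^c$ vertices (fixed independently of the random graph $G=G(n,p)$): 1. no induced subgraph $H=G[U]$ determines whether $G$ has a dominating set of size $k$: for every property $f$ of graphs with vertex set $U$, the statement "$f(G[U])$ holds if and only if $G$ has a dominating set of size $k$" fails with probability at least $\rho$; 2. with probability at least $\rho$, $G$ has a unique dominating set of size $k$ and some symmetry mapping outside $U$ turns it into a graph with no dominating set of size $k$; and the probability that $G$ has a unique dominating set of size $k$ but no symmetry mapping outside $U$ does this is at most $\varepsilon$; 3. with probability at least $\rho$, $G$ has no dominating set of size $k$ and some symmetry mapping outside $U$ turns it into a graph with a unique dominating set of size $k$; and the probability that $G$ has no dominating set of size $k$ but no symmetry mapping outside $U$ does this is at most $\varepsilon$. -/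

import Mathlib

open Filter Topology MeasureTheory unitInterval
open scoped SimpleGraph

/-- `S` is a dominating set of `G`: every vertex is in `S` or adjacent to a vertex of `S`. -/
def IsDominatingSet {V : Type*} (G : SimpleGraph V) (S : Finset V) : Prop :=
  ∀ v : V, v ∈ S ∨ ∃ u ∈ S, G.Adj u v

/-- The collection of all dominating sets of `G` with exactly `k` vertices. -/
def domSets {V : Type*} (G : SimpleGraph V) (k : ℕ) : Set (Finset V) :=
  {S | S.card = k ∧ IsDominatingSet G S}

/-- `G` contains a dominating set of size `k`. -/
def HasDomSet {V : Type*} (G : SimpleGraph V) (k : ℕ) : Prop :=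
  ∃ S : Finset V, S ∈ domSets G k

/-- `G` contains exactly one dominating set of size `k`. -/
def HasUniqueDomSet {V : Type*} (G : SimpleGraph V) (k : ℕ) : Prop :=
  ∃! S : Finset V, S ∈ domSets G k

/-- The expected number of dominating sets of size `k` in the random graph `G(n, p)`. -/
noncomputable def expectedDomSets (n k : ℕ) (p : I) : ℝ :=
  ∫ G, ((domSets G k).ncard : ℝ) ∂G(Fin n, p)

/-- A symmetry mapping outside `U`: there are four distinct vertices `u, v, z, w` outside `U`
which span in `G` exactly the two edges `uv` and `zw`, and `G'` arises from `G` by replacing these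
two edges with `uz` and `vw`. -/
def IsSymmetrySwap {V : Type*} (U : Finset V) (G G' : SimpleGraph V) : Prop :=
  ∃ u v z w : V, u ∉ U ∧ v ∉ U ∧ z ∉ U ∧ w ∉ U ∧ [u, v, z, w].Nodup ∧
    G.Adj u v ∧ G.Adj z w ∧ ¬ G.Adj u z ∧ ¬ G.Adj u w ∧ ¬ G.Adj v z ∧ ¬ G.Adj v w ∧
    G' = SimpleGraph.fromEdgeSet ((G.edgeSet \ {s(u, v), s(z, w)}) ∪ {s(u, z), s(v, w)})

/-- `G` can be turned, by a symmetry mapping outside `U` (which leaves the subgraph induced on `U`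
unchanged), into a graph that has the property `Q`. -/
def SwapsTo {V : Type*} (U : Finset V) (G : SimpleGraph V) (Q : SimpleGraph V → Prop) : Prop :=
  ∃ G' : SimpleGraph V, IsSymmetrySwap U G G' ∧
    G'.induce (U : Set V) = G.induce (U : Set V) ∧ Q G'

/-- The problem whether `G(n, p n)` has a dominating set of size `k n` is reducible: for some
constant `0 < c < 1` there are vertex sets `U n` of order at most `n ^ c` such that, with high
probability, the subgraph induced on `U n` contains a dominating set of size `k n` if and only if
the whole graph does. -/
def DominationReducible (k : ℕ → ℕ) (p : ℕ → I) : Prop :=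
  ∃ c : ℝ, 0 < c ∧ c < 1 ∧ ∃ U : (n : ℕ) → Finset (Fin n),
    (∀ n, ((U n).card : ℝ) ≤ (n : ℝ) ^ c) ∧
    Tendsto (fun n : ℕ => G(Fin n, p n).real
      {G | HasDomSet (G.induce (U n : Set (Fin n))) (k n) ↔ HasDomSet G (k n)}) atTop (𝓝 1)

/-! Write q = 1 - p, y = q^k, L = ln n. A k-set T misses each vertex outside T independently with
probability y, so the expected number of dominating k-sets is C(n,k)(1-y)^(n-k). If this tends to δ,
then ny has order L² and q stays inside [1/8, 1/2] (`nearThreshold_of_expectation`).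

The proof follows the near-dominating sets, the k-sets missing at most two vertices. Exponential
Markov with tilt 1/L² shows that their expected number is polylogarithmic
(`choose_mul_nearBound_le`), so with high probability together with their missed vertices they cover
fewer than √n vertices. A fixed vertex lies in one of them with probability polylog/n, so with high
probability none meets a set U of size n^c. Distinct ones are with high probability pairwise
disjoint, because intersecting pairs are rare (`pairBound_le`). Disjoint pairs behave almost
independently. The second factorial moment is therefore about δ², which makes a unique dominating
set at least about δ - δ² likely, while having none is at least 1 - δ likely by Markov. Sets missing
at most one vertex have expectation of order at least L², so by Chebyshev one exists with high
probability.

Decisions from G[U]: up to a rare event, domination is decided by k-sets disjoint from U, and those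
see no edge inside U. The answer is thus independent of G[U], and an independent guess errs with
probability at least the smaller of the two answer probabilities (`le_real_decision_error`).

Swaps: a new edge can rescue at most one missed vertex of a given T, so a set that dominates after a
swap was near-dominating before. If the auxiliary vertices are chosen away from U and from
everything related to near-dominating sets, a swap affects only the intended set. It destroys the
unique dominating set by cutting off a private neighbour (`swapsTo_not_hasDomSet`), or completes a
set with a single missed vertex (`swapsTo_hasUniqueDomSet`). The auxiliary vertices exist because
every adjacency pattern to three vertices occurs linearly often. -/

set_option linter.unusedSectionVars false

/-! ### Independence of events supported on disjoint sets of potential edges. -/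

section EdgeIndependence

open ProbabilityTheory

variable {V : Type*} [Fintype V]

/-- Makes every event and every function of the random graph measurable, so measurability and
integrability cost nothing later. -/
instance SimpleGraph.discreteMeasurableSpace_of_finite :
    DiscreteMeasurableSpace (SimpleGraph V) := by
  have : MeasurableSingletonClass (SimpleGraph V) := by
    refine ⟨fun G => ?_⟩
    have h := SimpleGraph.measurable_edgeSet (V := V) (measurableSet_singleton G.edgeSet)
    convert h using 1
    ext G'
    simp
  infer_instance

/-- The value of `f` at a graph is determined by the edges of that graph inside `F`. -/
def DeterminedBy {β : Type*} (F : Set (Sym2 V)) (f : SimpleGraph V → β) : Prop :=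
  ∀ G G' : SimpleGraph V, (∀ e ∈ F, e ∈ G.edgeSet ↔ e ∈ G'.edgeSet) → f G = f G'

lemma DeterminedBy.mono {β : Type*} {F F' : Set (Sym2 V)} {f : SimpleGraph V → β}
    (h : DeterminedBy F f) (hF : F ⊆ F') : DeterminedBy F' f :=
  fun G G' hG => h G G' fun e he => hG e (hF he)

/-- The independent coins whose outcomes decide which edges are present. -/
noncomputable def edgeCoins (V : Type*) (p : I) : Measure (Sym2 V → Prop) :=
  Measure.infinitePi fun e : Sym2 V =>
    toNNReal p • Measure.dirac (e ∈ (Sym2.diagSetᶜ : Set (Sym2 V))) +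
      toNNReal (σ p) • Measure.dirac False

/-- The graph obtained from the coin outcomes. -/
def coinGraph (ω : Sym2 V → Prop) : SimpleGraph V := SimpleGraph.fromEdgeSet {e | ω e}

lemma mem_edgeSet_coinGraph (ω : Sym2 V → Prop) (e : Sym2 V) :
    e ∈ (coinGraph ω).edgeSet ↔ ω e ∧ ¬ e.IsDiag := by
  simp [coinGraph]

instance (p : I) : IsProbabilityMeasure (edgeCoins V p) := by
  unfold edgeCoins
  infer_instance

lemma binomialRandom_eq_map_edgeCoins (p : I) :
    G(V, p) = (edgeCoins V p).map coinGraph := by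
  rw [SimpleGraph.binomialRandom_eq_map, setBernoulli_eq_map, Measure.map_map]
  · rfl
  · exact SimpleGraph.measurable_fromEdgeSet
  · exact MeasurableEquiv.setOfPred.measurable

lemma measurable_coinGraph : Measurable (coinGraph : (Sym2 V → Prop) → SimpleGraph V) :=
  SimpleGraph.measurable_fromEdgeSet.comp MeasurableEquiv.setOfPred.measurable

lemma integral_binomialRandom (p : I) (f : SimpleGraph V → ℝ) :
    ∫ G, f G ∂G(V, p) = ∫ ω, f (coinGraph ω) ∂(edgeCoins V p) := by
  rw [binomialRandom_eq_map_edgeCoins, integral_map measurable_coinGraph.aemeasurable]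
  exact (measurable_of_finite f).aestronglyMeasurable

/-- Factoring through the coins in `F` is the form in which independence of disjoint families of
coordinates applies. -/
lemma DeterminedBy.exists_factor [DecidableEq V] {F : Finset (Sym2 V)} {f : SimpleGraph V → ℝ}
    (h : DeterminedBy (F : Set (Sym2 V)) f) :
    ∃ g : (F → Prop) → ℝ, ∀ ω : Sym2 V → Prop, f (coinGraph ω) = g fun e => ω e := by
  classical
  -- Coins outside `F` are set to `False`; any value would do, as `f` does not see them.
  refine ⟨fun x => f (coinGraph fun e => if he : e ∈ F then x ⟨e, he⟩ else False), fun ω => ?_⟩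
  apply h
  intro e he
  have he' : e ∈ F := by simpa using he
  simp [mem_edgeSet_coinGraph, he']

lemma integral_mul_of_determinedBy_disjoint [DecidableEq V] (p : I) {F₁ F₂ : Finset (Sym2 V)}
    (hF : Disjoint F₁ F₂) {f₁ f₂ : SimpleGraph V → ℝ}
    (h₁ : DeterminedBy (F₁ : Set (Sym2 V)) f₁) (h₂ : DeterminedBy (F₂ : Set (Sym2 V)) f₂) :
    ∫ G, f₁ G * f₂ G ∂G(V, p) = (∫ G, f₁ G ∂G(V, p)) * ∫ G, f₂ G ∂G(V, p) := by
  obtain ⟨g₁, hg₁⟩ := h₁.exists_factor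
  obtain ⟨g₂, hg₂⟩ := h₂.exists_factor
  simp only [integral_binomialRandom, hg₁, hg₂]
  have hind : iIndepFun (fun (e : Sym2 V) (ω : Sym2 V → Prop) => ω e) (edgeCoins V p) :=
    iIndepFun_infinitePi (X := fun _ => id) (fun _ => measurable_id)
  have h := hind.indepFun_finset F₁ F₂ hF (fun e => measurable_pi_apply e)
  have h' := h.comp (φ := g₁) (ψ := g₂) (measurable_of_finite g₁) (measurable_of_finite g₂)
  have := h'.integral_fun_mul_eq_mul_integral
    (((measurable_of_finite g₁).comp (by fun_prop)).aestronglyMeasurable)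
    (((measurable_of_finite g₂).comp (by fun_prop)).aestronglyMeasurable)
  simpa [Function.comp_def] using this

lemma real_eq_integral_ite (p : I) (P : SimpleGraph V → Prop) [DecidablePred P] :
    G(V, p).real {G | P G} = ∫ G, (if P G then (1 : ℝ) else 0) ∂G(V, p) := by
  have h := integral_indicator_one (μ := G(V, p)) (s := {G | P G}) (MeasurableSet.of_discrete)
  rw [← h]
  congr 1
  ext G
  by_cases hG : P G <;> simp [hG]

lemma DeterminedBy.comp {β γ : Type*} {F : Set (Sym2 V)} {f : SimpleGraph V → β}
    (h : DeterminedBy F f) (g : β → γ) : DeterminedBy F (fun G => g (f G)) :=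
  fun G G' hG => congrArg g (h G G' hG)

lemma DeterminedBy.prod {α : Type*} {B : Finset α} {F : Set (Sym2 V)}
    {f : α → SimpleGraph V → ℝ} (h : ∀ x ∈ B, DeterminedBy F (f x)) :
    DeterminedBy F fun G => ∏ x ∈ B, f x G :=
  fun G G' hG => Finset.prod_congr rfl fun x hx => h x hx G G' hG

lemma integral_prod_of_determinedBy [DecidableEq V] {α : Type*} (p : I) (B : Finset α)
    (F : α → Finset (Sym2 V)) (f : α → SimpleGraph V → ℝ)
    (hF : (B : Set α).PairwiseDisjoint F)
    (hf : ∀ x ∈ B, DeterminedBy (F x : Set (Sym2 V)) (f x)) :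
    ∫ G, ∏ x ∈ B, f x G ∂G(V, p) = ∏ x ∈ B, ∫ G, f x G ∂G(V, p) := by
  classical
  induction B using Finset.induction_on with
  | empty => simp
  | insert a B ha ih =>
    simp only [Finset.prod_insert ha]
    rw [integral_mul_of_determinedBy_disjoint p (F₁ := F a) (F₂ := B.biUnion F), ih]
    · exact hF.subset (by simp)
    · exact fun x hx => hf x (Finset.mem_insert_of_mem hx)
    · rw [Finset.disjoint_biUnion_right]
      intro x hx
      exact hF (by simp) (by simp [hx]) (by rintro rfl; exact ha hx)
    · exact hf a (Finset.mem_insert_self _ _)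
    · apply DeterminedBy.prod
      intro x hx
      refine (hf x (Finset.mem_insert_of_mem hx)).mono ?_
      exact_mod_cast Finset.subset_biUnion_of_mem F hx

open scoped Classical in
lemma integral_adj (p : I) {x a : V} (h : x ≠ a) :
    ∫ G, (if G.Adj x a then (1 : ℝ) else 0) ∂G(V, p) = p := by
  rw [integral_binomialRandom]
  have hc : ∀ ω : Sym2 V → Prop, (coinGraph ω).Adj x a ↔ ω s(x, a) := by
    intro ω
    rw [← SimpleGraph.mem_edgeSet, mem_edgeSet_coinGraph]
    simp [h]
  simp only [hc]
  have hm := (measurePreserving_eval_infinitePi (fun e : Sym2 V =>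
    toNNReal p • Measure.dirac (e ∈ (Sym2.diagSetᶜ : Set (Sym2 V))) +
      toNNReal (σ p) • Measure.dirac False) s(x, a))
  have h2 : ∫ ω, (if ω s(x, a) then (1 : ℝ) else 0) ∂(edgeCoins V p) =
      ∫ b : Prop, (if b then (1 : ℝ) else 0) ∂((edgeCoins V p).map (Function.eval s(x, a))) := by
    rw [integral_map hm.measurable.aemeasurable
      (measurable_of_finite _).aestronglyMeasurable]
  rw [h2, show (edgeCoins V p).map (Function.eval s(x, a)) = _ from hm.map_eq]
  rw [integral_add_measure Integrable.of_finite Integrable.of_finite]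
  simp [h, NNReal.smul_def]

/-- The potential edges between a vertex and a set. -/
def starEdges [DecidableEq V] (A : Finset V) (x : V) : Finset (Sym2 V) := A.image fun a => s(x, a)

/-- A one-sided hypothesis suffices: a common edge s(x, a) = s(x', b) with x ≠ x' forces x = b ∈ A'.
-/
lemma disjoint_starEdges [DecidableEq V] {A A' : Finset V} {x x' : V} (hxx : x ≠ x')
    (hx : x ∉ A') : Disjoint (starEdges A x) (starEdges A' x') := by
  rw [Finset.disjoint_left]
  simp only [starEdges, Finset.mem_image, not_exists, not_and]
  rintro e ⟨a, ha, rfl⟩ b hb h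
  rw [Sym2.eq_iff] at h
  rcases h with ⟨h1, h2⟩ | ⟨h1, h2⟩
  · exact hxx h1.symm
  · exact hx (h2 ▸ hb)

lemma determinedBy_starEdges [DecidableEq V] {β : Type*} {A : Finset V} {x : V}
    {f : SimpleGraph V → β}
    (h : ∀ G G' : SimpleGraph V, (∀ a ∈ A, G.Adj x a ↔ G'.Adj x a) → f G = f G') :
    DeterminedBy (starEdges A x : Set (Sym2 V)) f := by
  intro G G' hG
  apply h
  intro a ha
  have := hG s(x, a) (by simp only [starEdges, Finset.coe_image]; exact ⟨a, ha, rfl⟩)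
  simpa using this

open scoped Classical in
/-- The probability that a vertex sees a given pattern on a set. -/
lemma integral_pattern [DecidableEq V] (p : I) (A P : Finset V) {x : V} (hx : x ∉ A) :
    ∫ G, (if ∀ a ∈ A, (G.Adj x a ↔ a ∈ P) then (1 : ℝ) else 0) ∂G(V, p) =
      ∏ a ∈ A, if a ∈ P then (p : ℝ) else 1 - p := by
  have h1 : ∀ G : SimpleGraph V, (if ∀ a ∈ A, (G.Adj x a ↔ a ∈ P) then (1 : ℝ) else 0) =
      ∏ a ∈ A, if (G.Adj x a ↔ a ∈ P) then (1 : ℝ) else 0 := fun G => by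
    rw [Finset.prod_ite_zero]; simp
  simp only [h1]
  rw [integral_prod_of_determinedBy p A (fun a => {s(x, a)})]
  · refine Finset.prod_congr rfl fun a ha => ?_
    have hxa : x ≠ a := fun h => hx (h ▸ ha)
    by_cases hP : a ∈ P
    · simp only [hP, iff_true, if_true]; exact integral_adj p hxa
    · have h2 : ∀ G : SimpleGraph V, (if (G.Adj x a ↔ a ∈ P) then (1 : ℝ) else 0) =
          1 - if G.Adj x a then (1 : ℝ) else 0 := fun G => by
        by_cases h : G.Adj x a <;> simp [h, hP]
      simp only [h2]
      rw [if_neg hP, integral_sub Integrable.of_finite Integrable.of_finite, integral_adj p hxa]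
      simp
  · intro a ha b hb hab
    simp only [Function.onFun, Finset.disjoint_singleton]
    intro h
    rw [Sym2.eq_iff] at h
    rcases h with h | h
    · exact hab h.2
    · exact hx (h.1 ▸ hb)
  · intro a ha G G' hG
    have := hG s(x, a) (by simp)
    simp only [SimpleGraph.mem_edgeSet] at this
    simp [this]

open scoped Classical in
lemma real_pattern [DecidableEq V] (p : I) (A P : Finset V) {x : V} (hx : x ∉ A) :
    G(V, p).real {G | ∀ a ∈ A, (G.Adj x a ↔ a ∈ P)} = ∏ a ∈ A, if a ∈ P then (p : ℝ) else 1 - p := by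
  rw [real_eq_integral_ite, ← integral_pattern p A P hx]

lemma real_no_neighbor [DecidableEq V] (p : I) (A : Finset V) {x : V} (hx : x ∉ A) :
    G(V, p).real {G | ∀ a ∈ A, ¬ G.Adj x a} = (1 - p : ℝ) ^ A.card := by
  have := real_pattern p A ∅ hx
  simpa using this

-- The generating function of the number of events that occur. At t = 0 it is the probability that
-- none occurs; for 0 < t ≤ 1 it feeds the exponential Markov inequality.
open scoped Classical in
lemma integral_tilt [DecidableEq V] (p : I) (B : Finset V) (F : V → Finset (Sym2 V))
    (e : V → SimpleGraph V → Prop) (hF : (B : Set V).PairwiseDisjoint F)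
    (he : ∀ x ∈ B, DeterminedBy (F x : Set (Sym2 V)) (e x)) (g t : ℝ)
    (hg : ∀ x ∈ B, G(V, p).real {G | e x G} = g) :
    ∫ G, ∏ x ∈ B, (if e x G then t else 1) ∂G(V, p) = (1 - (1 - t) * g) ^ B.card := by
  rw [integral_prod_of_determinedBy p B F (fun x G => if e x G then t else 1) hF]
  · rw [← Finset.prod_const]
    refine Finset.prod_congr rfl fun x hx => ?_
    have h1 : ∀ G, (if e x G then t else 1) = 1 - (1 - t) * (if e x G then (1 : ℝ) else 0) := by
      intro G; split_ifs <;> ring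
    simp only [h1]
    rw [integral_sub Integrable.of_finite Integrable.of_finite, integral_const_mul,
      ← real_eq_integral_ite, hg x hx]
    simp
  · exact fun x hx => (he x hx).comp fun P => if P then t else 1

open scoped Classical in
lemma real_none [DecidableEq V] (p : I) (B : Finset V) (F : V → Finset (Sym2 V))
    (e : V → SimpleGraph V → Prop) (hF : (B : Set V).PairwiseDisjoint F)
    (he : ∀ x ∈ B, DeterminedBy (F x : Set (Sym2 V)) (e x)) (g : ℝ)
    (hg : ∀ x ∈ B, G(V, p).real {G | e x G} = g) :
    G(V, p).real {G | ∀ x ∈ B, ¬ e x G} = (1 - g) ^ B.card := by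
  have h := integral_tilt p B F e hF he g 0 hg
  rw [real_eq_integral_ite]
  simp only [sub_zero, one_mul] at h
  rw [← h]
  congr 1
  ext G
  have : ∏ x ∈ B, (if e x G then (0 : ℝ) else 1) = ∏ x ∈ B, (if ¬ e x G then (1 : ℝ) else 0) :=
    Finset.prod_congr rfl fun x _ => by split_ifs <;> simp_all
  rw [this, Finset.prod_ite_zero]
  simp

open scoped Classical in
/-- Exponential Markov inequality for the number of independent events that happen. -/
lemma real_card_le [DecidableEq V] (p : I) (B : Finset V) (F : V → Finset (Sym2 V))
    (e : V → SimpleGraph V → Prop) (hF : (B : Set V).PairwiseDisjoint F)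
    (he : ∀ x ∈ B, DeterminedBy (F x : Set (Sym2 V)) (e x)) (g t : ℝ) (ht : 0 < t) (ht1 : t ≤ 1)
    (hg : ∀ x ∈ B, G(V, p).real {G | e x G} = g) (r : ℕ) :
    G(V, p).real {G | (B.filter fun x => e x G).card ≤ r} ≤
      (t ^ r)⁻¹ * (1 - (1 - t) * g) ^ B.card := by
  rw [← integral_tilt p B F e hF he g t hg, ← integral_const_mul, real_eq_integral_ite]
  refine integral_mono Integrable.of_finite Integrable.of_finite fun G => ?_
  dsimp only
  rw [Finset.prod_ite]
  simp only [Finset.prod_const, one_pow, mul_one]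
  split_ifs with h
  · rw [inv_mul_eq_div, one_le_div (by positivity)]
    exact pow_le_pow_of_le_one ht.le ht1 h
  · positivity

end EdgeIndependence

/-! ### The law of the set of vertices missed by one k-set or by two. -/

section UndominatedVertices

variable {V : Type*} [Fintype V] [DecidableEq V]

-- Fixing the exact set of occurring events yields both the binomial law and the probability of one
-- prescribed missed vertex.
open scoped Classical in
lemma real_filter_eq (p : I) (B : Finset V) (F : V → Finset (Sym2 V))
    (e : V → SimpleGraph V → Prop) (hF : (B : Set V).PairwiseDisjoint F)
    (he : ∀ x ∈ B, DeterminedBy (F x : Set (Sym2 V)) (e x)) (g : ℝ)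
    (hg : ∀ x ∈ B, G(V, p).real {G | e x G} = g) (Z : Finset V) (hZ : Z ⊆ B) :
    G(V, p).real {G | (B.filter fun x => e x G) = Z} = g ^ Z.card * (1 - g) ^ (B.card - Z.card) := by
  have h1 : ∀ G, (if (B.filter fun x => e x G) = Z then (1 : ℝ) else 0) =
      ∏ x ∈ B, if (e x G ↔ x ∈ Z) then (1 : ℝ) else 0 := by
    intro G
    rw [Finset.prod_ite_zero, Finset.prod_const_one]
    congr 1
    refine propext ?_
    constructor
    · rintro rfl x hx
      simp [hx]
    · intro h
      ext x
      simp only [Finset.mem_filter]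
      exact ⟨fun hx => (h x hx.1).1 hx.2, fun hx => ⟨hZ hx, (h x (hZ hx)).2 hx⟩⟩
  rw [real_eq_integral_ite]
  simp only [h1]
  rw [integral_prod_of_determinedBy p B F (fun x G => if (e x G ↔ x ∈ Z) then (1 : ℝ) else 0) hF
    (fun x hx => (he x hx).comp fun P => if (P ↔ x ∈ Z) then (1 : ℝ) else 0)]
  have h2 : ∀ x ∈ B, ∫ G, (if (e x G ↔ x ∈ Z) then (1 : ℝ) else 0) ∂G(V, p) =
      if x ∈ Z then g else 1 - g := by
    intro x hx
    by_cases hxZ : x ∈ Z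
    · rw [if_pos hxZ, ← hg x hx, real_eq_integral_ite]
      simp [hxZ]
    · have h3 : ∀ G, (if (e x G ↔ x ∈ Z) then (1 : ℝ) else 0) =
          1 - if e x G then (1 : ℝ) else 0 := by
        intro G
        by_cases h : e x G <;> simp [h, hxZ]
      simp only [h3]
      rw [if_neg hxZ, ← hg x hx, real_eq_integral_ite, integral_sub Integrable.of_finite
        Integrable.of_finite]
      simp
  rw [Finset.prod_congr rfl h2, Finset.prod_ite, Finset.prod_const, Finset.prod_const,
    Finset.filter_not, Finset.filter_mem_eq_inter, Finset.inter_eq_right.2 hZ,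
    Finset.card_sdiff_of_subset hZ]

/-- The probability that a binomial random variable is at most `r`. -/
noncomputable def binomialCdf (m : ℕ) (g : ℝ) (r : ℕ) : ℝ :=
  ∑ j ∈ Finset.range (r + 1), (m.choose j : ℝ) * (g ^ j * (1 - g) ^ (m - j))

/-- If k additional trials all fail, the number of successes is unchanged. -/
lemma binomialCdf_mul_le (m k r : ℕ) {g : ℝ} (hg0 : 0 ≤ g) (hg1 : g ≤ 1) :
    binomialCdf m g r * (1 - g) ^ k ≤ binomialCdf (m + k) g r := by
  unfold binomialCdf
  rw [Finset.sum_mul]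
  refine Finset.sum_le_sum fun j _ => ?_
  have hg : 0 ≤ 1 - g := by linarith
  by_cases hj : j ≤ m
  · have : (m.choose j : ℝ) ≤ (m + k).choose j := by
      exact_mod_cast Nat.choose_le_choose j (Nat.le_add_right m k)
    calc (m.choose j : ℝ) * (g ^ j * (1 - g) ^ (m - j)) * (1 - g) ^ k
        = (m.choose j : ℝ) * (g ^ j * (1 - g) ^ (m + k - j)) := by
          rw [show m + k - j = (m - j) + k by omega, pow_add]; ring
      _ ≤ _ := by gcongr
  · rw [Nat.choose_eq_zero_of_lt (by omega)]
    simp only [Nat.cast_zero, zero_mul]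
    positivity

lemma binomialCdf_nonneg (m r : ℕ) {g : ℝ} (hg0 : 0 ≤ g) (hg1 : g ≤ 1) : 0 ≤ binomialCdf m g r := by
  have hg : 0 ≤ 1 - g := by linarith
  unfold binomialCdf
  positivity

lemma binomialCdf_zero (m : ℕ) (g : ℝ) : binomialCdf m g 0 = (1 - g) ^ m := by
  simp [binomialCdf]

lemma binomialCdf_one (m : ℕ) (g : ℝ) :
    binomialCdf m g 1 = (1 - g) ^ m + m * (g * (1 - g) ^ (m - 1)) := by
  simp [binomialCdf, Finset.sum_range_succ]

lemma real_mem_finset {β : Type*} [DecidableEq β] (p : I) (f : SimpleGraph V → β)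
    (S : Finset β) : G(V, p).real {G | f G ∈ S} = ∑ z ∈ S, G(V, p).real {G | f G = z} := by
  rw [← measureReal_biUnion_finset]
  · congr 1
    ext G
    simp
  · intro a _ b _ hab
    simp only [Function.onFun]
    rw [Set.disjoint_left]
    rintro G (rfl : f G = a) (h : f G = b)
    exact hab h
  · exact fun _ _ => MeasurableSet.of_discrete

open scoped Classical in
lemma real_card_le_eq (p : I) (B : Finset V) (F : V → Finset (Sym2 V))
    (e : V → SimpleGraph V → Prop) (hF : (B : Set V).PairwiseDisjoint F)
    (he : ∀ x ∈ B, DeterminedBy (F x : Set (Sym2 V)) (e x)) (g : ℝ)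
    (hg : ∀ x ∈ B, G(V, p).real {G | e x G} = g) (r : ℕ) :
    G(V, p).real {G | (B.filter fun x => e x G).card ≤ r} = binomialCdf B.card g r := by
  have h1 : {G : SimpleGraph V | (B.filter fun x => e x G).card ≤ r} =
      {G | (B.filter fun x => e x G) ∈
        (Finset.range (r + 1)).biUnion fun j => B.powersetCard j} := by
    ext G
    simp only [Set.mem_ofPred_eq, Finset.mem_biUnion, Finset.mem_range, Finset.mem_powersetCard]
    exact ⟨fun h => ⟨_, by omega, Finset.filter_subset _ _, rfl⟩, by rintro ⟨j, hj, -, h⟩; omega⟩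
  rw [h1, real_mem_finset, Finset.sum_biUnion]
  · unfold binomialCdf
    refine Finset.sum_congr rfl fun j _ => ?_
    rw [← Finset.card_powersetCard, ← nsmul_eq_mul, ← Finset.sum_const]
    refine Finset.sum_congr rfl fun Z hZ => ?_
    rw [Finset.mem_powersetCard] at hZ
    rw [real_filter_eq p B F e hF he g hg Z hZ.1, hZ.2]
  · exact fun i _ j _ hij => Finset.pairwise_disjoint_powersetCard _ hij

/-- No vertex of `T` is adjacent to `x`. -/
def NoNeighborIn (T : Finset V) (x : V) (G : SimpleGraph V) : Prop := ∀ a ∈ T, ¬ G.Adj x a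

lemma determinedBy_noNeighborIn (T : Finset V) (x : V) :
    DeterminedBy (starEdges T x : Set (Sym2 V)) (NoNeighborIn T x) := by
  apply determinedBy_starEdges
  intro G G' h
  unfold NoNeighborIn
  exact propext (forall₂_congr fun a ha => not_congr (h a ha))

lemma pairwiseDisjoint_starEdges {A B : Finset V} (h : Disjoint A B) :
    (B : Set V).PairwiseDisjoint (starEdges A) :=
  fun _ hx _ _ hxy => disjoint_starEdges hxy (Finset.disjoint_right.1 h hx)

lemma real_noNeighborIn (p : I) (T : Finset V) {x : V} (hx : x ∉ T) :
    G(V, p).real {G | NoNeighborIn T x G} = (1 - p : ℝ) ^ T.card :=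
  real_no_neighbor p T hx

open scoped Classical in
/-- The vertices that are not dominated by `T`. -/
noncomputable def undominated (G : SimpleGraph V) (T : Finset V) : Finset V :=
  Tᶜ.filter fun x => NoNeighborIn T x G

lemma mem_undominated {G : SimpleGraph V} {T : Finset V} {x : V} :
    x ∈ undominated G T ↔ x ∉ T ∧ ∀ a ∈ T, ¬ G.Adj x a := by
  classical
  rw [undominated, Finset.mem_filter, Finset.mem_compl]
  rfl

lemma isDominatingSet_iff {G : SimpleGraph V} {T : Finset V} :
    IsDominatingSet G T ↔ undominated G T = ∅ := by
  simp only [Finset.eq_empty_iff_forall_notMem, mem_undominated, IsDominatingSet]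
  refine forall_congr' fun v => ?_
  push Not
  simp only [G.adj_comm v]
  tauto

/-- The `k`-sets that leave at most `r` vertices undominated. -/
noncomputable def nearDomSets (G : SimpleGraph V) (k r : ℕ) : Finset (Finset V) :=
  ((Finset.univ : Finset V).powersetCard k).filter fun T => (undominated G T).card ≤ r

lemma mem_nearDomSets {G : SimpleGraph V} {k r : ℕ} {T : Finset V} :
    T ∈ nearDomSets G k r ↔ T.card = k ∧ (undominated G T).card ≤ r := by
  simp [nearDomSets, Finset.mem_powersetCard]

lemma mem_domSets_iff {G : SimpleGraph V} {k : ℕ} {T : Finset V} :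
    T ∈ domSets G k ↔ T ∈ nearDomSets G k 0 := by
  simp [domSets, mem_nearDomSets, isDominatingSet_iff]

lemma domSets_eq (G : SimpleGraph V) (k : ℕ) : domSets G k = nearDomSets G k 0 :=
  Set.ext fun _ => mem_domSets_iff

lemma real_undominated_card_le (p : I) (T : Finset V) (r : ℕ) :
    G(V, p).real {G | (undominated G T).card ≤ r} =
      binomialCdf (Fintype.card V - T.card) ((1 - p : ℝ) ^ T.card) r := by
  classical
  have := real_card_le_eq p Tᶜ (starEdges T) (NoNeighborIn T)
    (pairwiseDisjoint_starEdges disjoint_compl_right)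
    (fun x _ => determinedBy_noNeighborIn T x) _
    (fun x hx => real_noNeighborIn p T (by simpa using hx)) r
  rw [Finset.card_compl] at this
  rw [← this]
  rfl

lemma real_undominated_eq_singleton (p : I) (T : Finset V) {z : V} (hz : z ∉ T) :
    G(V, p).real {G | undominated G T = {z}} =
      (1 - p : ℝ) ^ T.card * (1 - (1 - p : ℝ) ^ T.card) ^ (Fintype.card V - T.card - 1) := by
  classical
  have := real_filter_eq p Tᶜ (starEdges T) (NoNeighborIn T)
    (pairwiseDisjoint_starEdges disjoint_compl_right)
    (fun x _ => determinedBy_noNeighborIn T x) _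
    (fun x hx => real_noNeighborIn p T (by simpa using hx)) {z} (by simpa using hz)
  rw [Finset.card_compl, Finset.card_singleton, pow_one] at this
  rw [← this]
  rfl

lemma real_undominated_card_le_tilt (p : I) (T : Finset V) (r : ℕ) {t : ℝ} (ht : 0 < t)
    (ht1 : t ≤ 1) :
    G(V, p).real {G | (undominated G T).card ≤ r} ≤
      (t ^ r)⁻¹ * (1 - (1 - t) * (1 - p : ℝ) ^ T.card) ^ (Fintype.card V - T.card) := by
  classical
  have := real_card_le p Tᶜ (starEdges T) (NoNeighborIn T)
    (pairwiseDisjoint_starEdges disjoint_compl_right)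
    (fun x _ => determinedBy_noNeighborIn T x) _ t ht ht1
    (fun x hx => real_noNeighborIn p T (by simpa using hx)) r
  rw [Finset.card_compl] at this
  exact this

lemma real_mono {p : I} {P Q : SimpleGraph V → Prop} (h : ∀ G, P G → Q G) :
    G(V, p).real {G | P G} ≤ G(V, p).real {G | Q G} :=
  measureReal_mono h

lemma real_and_of_determinedBy_disjoint (p : I) {F₁ F₂ : Finset (Sym2 V)}
    (hF : Disjoint F₁ F₂) {P₁ P₂ : SimpleGraph V → Prop}
    (h₁ : DeterminedBy (F₁ : Set (Sym2 V)) P₁) (h₂ : DeterminedBy (F₂ : Set (Sym2 V)) P₂) :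
    G(V, p).real {G | P₁ G ∧ P₂ G} = G(V, p).real {G | P₁ G} * G(V, p).real {G | P₂ G} := by
  classical
  simp only [real_eq_integral_ite]
  rw [← integral_mul_of_determinedBy_disjoint p hF (h₁.comp fun P => if P then (1 : ℝ) else 0)
    (h₂.comp fun P => if P then (1 : ℝ) else 0)]
  congr 1
  ext G
  by_cases h : P₁ G <;> by_cases h' : P₂ G <;> simp [h, h']

/-- Only vertices outside both sets are counted. There the two counts are independent, since T and
T' being disjoint they use disjoint sets of potential edges. Each count ignores the k vertices of
the other set, which costs a factor (1-y)^(-k) apiece. -/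
lemma real_undominated_disjoint_pair (p : I) {T T' : Finset V} (hT : Disjoint T T') {k : ℕ}
    (hk : T.card = k) (hk' : T'.card = k) (r : ℕ) (hy : (1 - p : ℝ) ^ k < 1) :
    G(V, p).real {G | (undominated G T).card ≤ r ∧ (undominated G T').card ≤ r} ≤
      binomialCdf (Fintype.card V - k) ((1 - p : ℝ) ^ k) r ^ 2 *
        ((1 - (1 - p : ℝ) ^ k) ^ (2 * k))⁻¹ := by
  classical
  set y : ℝ := (1 - p : ℝ) ^ k with hy_def
  have hp : 0 ≤ (1 - p : ℝ) := sub_nonneg.2 p.2.2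
  have hy0 : 0 ≤ y := pow_nonneg hp _
  have hy1 : 0 < 1 - y := by linarith
  set B : Finset V := (T ∪ T')ᶜ with hB
  have hBc : B.card + k = Fintype.card V - k := by
    have h1 : T.card + T'.card = (T ∪ T').card := (Finset.card_union_of_disjoint hT).symm
    have h2 := Finset.card_le_univ (T ∪ T')
    rw [hB, Finset.card_compl]
    omega
  have hBT : Disjoint T B := by
    rw [hB]
    exact disjoint_compl_right.mono_left Finset.subset_union_left
  have hBT' : Disjoint T' B := by
    rw [hB]
    exact disjoint_compl_right.mono_left Finset.subset_union_right
  have key : ∀ S : Finset V, S.card = k → Disjoint S B →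
      G(V, p).real {G | (B.filter fun x => NoNeighborIn S x G).card ≤ r} =
        binomialCdf B.card y r := by
    intro S hS hSB
    refine real_card_le_eq p B (starEdges S) (NoNeighborIn S) (pairwiseDisjoint_starEdges hSB)
      (fun x _ => determinedBy_noNeighborIn S x) _ (fun x hx => ?_) r
    rw [real_noNeighborIn p S (Finset.disjoint_right.1 hSB hx), hS]
  have hdet : ∀ S : Finset V, DeterminedBy ((B.biUnion (starEdges S) : Finset _) : Set (Sym2 V))
      (fun G => (B.filter fun x => NoNeighborIn S x G).card ≤ r) := by
    intro S G G' hG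
    have : (B.filter fun x => NoNeighborIn S x G) = B.filter fun x => NoNeighborIn S x G' := by
      refine Finset.filter_congr fun x hx => ?_
      rw [determinedBy_noNeighborIn S x G G' fun e he => hG e ?_]
      exact_mod_cast Finset.subset_biUnion_of_mem (starEdges S) hx he
    simp only [this]
  have hdisj : Disjoint (B.biUnion (starEdges T)) (B.biUnion (starEdges T')) := by
    rw [Finset.disjoint_biUnion_left]
    intro x hx
    rw [Finset.disjoint_biUnion_right]
    intro x' hx'
    by_cases hxx : x = x'
    · subst hxx
      rw [Finset.disjoint_left]
      simp only [starEdges, Finset.mem_image, not_exists, not_and]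
      rintro e ⟨a, ha, rfl⟩ b hb h
      rw [Sym2.eq_iff] at h
      rcases h with h | h
      · exact Finset.disjoint_left.1 hT ha (h.2 ▸ hb)
      · exact Finset.disjoint_left.1 hBT ha (h.1 ▸ hx)
    · exact disjoint_starEdges hxx (Finset.disjoint_right.1 hBT' hx)
  calc G(V, p).real {G | (undominated G T).card ≤ r ∧ (undominated G T').card ≤ r}
      ≤ G(V, p).real {G | (B.filter fun x => NoNeighborIn T x G).card ≤ r ∧
          (B.filter fun x => NoNeighborIn T' x G).card ≤ r} := by
        refine real_mono fun G hG => ⟨le_trans (Finset.card_le_card ?_) hG.1,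
          le_trans (Finset.card_le_card ?_) hG.2⟩
        · exact Finset.filter_subset_filter _ (Finset.subset_compl_comm.1 (by
            rw [Finset.subset_compl_iff_disjoint_right]; exact hBT))
        · exact Finset.filter_subset_filter _ (Finset.subset_compl_comm.1 (by
            rw [Finset.subset_compl_iff_disjoint_right]; exact hBT'))
    _ = binomialCdf B.card y r ^ 2 := by
        rw [real_and_of_determinedBy_disjoint p hdisj (hdet T) (hdet T'), key T hk hBT,
          key T' hk' hBT', sq]
    _ ≤ _ := by
        rw [← div_eq_mul_inv, le_div_iff₀ (by positivity), pow_mul', ← mul_pow, ← hBc]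
        have h0 := binomialCdf_nonneg B.card r hy0 hy.le
        refine pow_le_pow_left₀ (by positivity) ?_ 2
        exact binomialCdf_mul_le B.card k r hy0 hy.le

/-- For overlapping sets the counts are dependent, so one counts vertices outside both that are
missed by at least one. By inclusion-exclusion this has probability 2q^k - q^(2k-i) per vertex,
independently over vertices, and at most 2r such vertices can occur. -/
lemma real_undominated_pair_tilt (p : I) {T T' : Finset V} {k i : ℕ}
    (hk : T.card = k) (hk' : T'.card = k) (hi : (T ∩ T').card = i) (r : ℕ) {t : ℝ} (ht : 0 < t)
    (ht1 : t ≤ 1) :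
    G(V, p).real {G | (undominated G T).card ≤ r ∧ (undominated G T').card ≤ r} ≤
      (t ^ (2 * r))⁻¹ * (1 - (1 - t) * (2 * (1 - p : ℝ) ^ k - (1 - p : ℝ) ^ (2 * k - i))) ^
        (Fintype.card V - 2 * k) := by
  classical
  have hp : 0 ≤ (1 - p : ℝ) := sub_nonneg.2 p.2.2
  have hp1 : (1 - p : ℝ) ≤ 1 := by linarith [p.2.1]
  have hun : (T ∪ T').card = 2 * k - i := by
    have := Finset.card_union_add_card_inter T T'
    omega
  set A := T ∪ T' with hA
  obtain ⟨e, he⟩ : ∃ e : V → SimpleGraph V → Prop,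
      e = fun x G => NoNeighborIn T x G ∨ NoNeighborIn T' x G := ⟨_, rfl⟩
  have hg : ∀ x ∈ Aᶜ, G(V, p).real {G | e x G} =
      2 * (1 - p : ℝ) ^ k - (1 - p : ℝ) ^ (2 * k - i) := by
    intro x hx
    have hxA : x ∉ A := by simpa using hx
    have hxT : x ∉ T := fun h => hxA (Finset.mem_union_left _ h)
    have hxT' : x ∉ T' := fun h => hxA (Finset.mem_union_right _ h)
    have h1 := measureReal_union_add_inter (μ := G(V, p)) (s := {G | NoNeighborIn T x G})
      (t := {G | NoNeighborIn T' x G}) MeasurableSet.of_discrete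
    have h2 : {G | NoNeighborIn T x G} ∩ {G | NoNeighborIn T' x G} = {G | NoNeighborIn A x G} := by
      ext G
      simp only [Set.mem_inter_iff, Set.mem_ofPred_eq, NoNeighborIn, hA, Finset.mem_union]
      exact ⟨fun h a ha => ha.elim (h.1 a) (h.2 a), fun h => ⟨fun a ha => h a (Or.inl ha),
        fun a ha => h a (Or.inr ha)⟩⟩
    rw [h2, real_noNeighborIn p T hxT, real_noNeighborIn p T' hxT', real_noNeighborIn p A hxA,
      hk, hk', hun] at h1
    have h3 : {G | e x G} = {G | NoNeighborIn T x G} ∪ {G | NoNeighborIn T' x G} := by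
      rw [he]
      rfl
    rw [h3]
    linarith
  have hdet : ∀ x ∈ Aᶜ, DeterminedBy (starEdges A x : Set (Sym2 V)) (e x) := by
    intro x _
    apply determinedBy_starEdges
    intro G G' h
    simp only [he, NoNeighborIn]
    refine propext (or_congr ?_ ?_)
    · exact forall₂_congr fun a ha => not_congr (h a (Finset.mem_union_left _ ha))
    · exact forall₂_congr fun a ha => not_congr (h a (Finset.mem_union_right _ ha))
  have h := real_card_le p Aᶜ (starEdges A) e (pairwiseDisjoint_starEdges disjoint_compl_right)
    hdet _ t ht ht1 hg (2 * r)
  rw [Finset.card_compl, hun] at h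
  have hsub : ∀ G, (Aᶜ.filter fun x => e x G) ⊆ undominated G T ∪ undominated G T' := by
    intro G x
    simp only [Finset.mem_filter, Finset.mem_compl, Finset.mem_union, mem_undominated, he,
      NoNeighborIn, hA, not_or]
    rintro ⟨⟨h1, h2⟩, h3 | h3⟩
    · exact Or.inl ⟨h1, h3⟩
    · exact Or.inr ⟨h2, h3⟩
  refine (real_mono fun G hG => ?_).trans (h.trans ?_)
  · have h1 := Finset.card_le_card (hsub G)
    have h2 := Finset.card_union_le (undominated G T) (undominated G T')
    have h3 := hG.1
    have h4 := hG.2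
    exact (h1.trans h2).trans (show _ ≤ 2 * r by omega)
  · have hpow : (1 - p : ℝ) ^ (2 * k - i) ≤ (1 - p : ℝ) ^ k :=
      pow_le_pow_of_le_one hp hp1 (by
        have : (T ∩ T').card ≤ T.card := Finset.card_le_card Finset.inter_subset_left
        omega)
    have hk1 : (1 - p : ℝ) ^ k ≤ 1 := pow_le_one₀ hp hp1
    have hk0 : 0 ≤ (1 - p : ℝ) ^ (2 * k - i) := pow_nonneg hp _
    set y := (1 - p : ℝ) ^ k
    set w := (1 - p : ℝ) ^ (2 * k - i)
    -- Lowering the exponent from |V| - (2k-i) to |V| - 2k requires a base in [0, 1].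
    have hgle : 2 * y - w ≤ 1 := by
      by_cases hne : (Aᶜ : Finset V).Nonempty
      · obtain ⟨x, hx⟩ := hne
        rw [← hg x hx]
        exact measureReal_le_one
      · have h4 : w = (1 - p : ℝ) ^ A.card := by rw [hun]
        have h5 : (1 - y) ^ 2 = 1 - 2 * y + y ^ 2 := by ring
        have h6 : y ^ 2 ≤ w := by
          rw [← pow_mul]
          exact pow_le_pow_of_le_one hp hp1 (by omega)
        nlinarith [sq_nonneg (1 - y)]
    have hb0 : 0 ≤ 1 - (1 - t) * (2 * y - w) := by nlinarith
    have hb1 : 1 - (1 - t) * (2 * y - w) ≤ 1 := by nlinarith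
    gcongr ?_ * ?_
    exact pow_le_pow_of_le_one hb0 hb1 (by omega)

end UndominatedVertices

/-! ### The deterministic effect of a symmetry mapping on dominating sets. -/

section SymmetrySwap

variable {V : Type*} [Fintype V] [DecidableEq V]

/-- The graph with the edges `uv` and `zw` replaced by `uz` and `vw`. -/
def swapGraph (G : SimpleGraph V) (u v z w : V) : SimpleGraph V :=
  SimpleGraph.fromEdgeSet ((G.edgeSet \ {s(u, v), s(z, w)}) ∪ {s(u, z), s(v, w)})

lemma swapGraph_adj {G : SimpleGraph V} {u v z w a b : V} :
    (swapGraph G u v z w).Adj a b ↔ a ≠ b ∧ ((G.Adj a b ∧ s(a, b) ≠ s(u, v) ∧ s(a, b) ≠ s(z, w)) ∨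
      s(a, b) = s(u, z) ∨ s(a, b) = s(v, w)) := by
  simp only [swapGraph, SimpleGraph.fromEdgeSet_adj, Set.mem_union, Set.mem_sdiff,
    SimpleGraph.mem_edgeSet, Set.mem_insert_iff, Set.mem_singleton_iff, not_or, ne_eq]
  tauto

lemma SwapsTo.of_swapGraph {G : SimpleGraph V} {U : Finset V} {u v z w : V}
    {Q : SimpleGraph V → Prop} (hu : u ∉ U) (hv : v ∉ U) (hz : z ∉ U) (hw : w ∉ U)
    (hnd : [u, v, z, w].Nodup) (huv : G.Adj u v) (hzw : G.Adj z w) (huz : ¬ G.Adj u z)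
    (huw : ¬ G.Adj u w) (hvz : ¬ G.Adj v z) (hvw : ¬ G.Adj v w)
    (hQ : Q (swapGraph G u v z w)) : SwapsTo U G Q := by
  refine ⟨swapGraph G u v z w, ⟨u, v, z, w, hu, hv, hz, hw, hnd, huv, hzw, huz, huw, hvz, hvw,
    rfl⟩, ?_, hQ⟩
  ext ⟨a, ha⟩ ⟨b, hb⟩
  have ha' : a ∈ U := by simpa using ha
  have hb' : b ∈ U := by simpa using hb
  simp only [SimpleGraph.comap_adj, Function.Embedding.subtype_apply, swapGraph_adj, Sym2.eq_iff,
    ne_eq]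
  have hau : a ≠ u := fun h => hu (h ▸ ha')
  have hav : a ≠ v := fun h => hv (h ▸ ha')
  have haz : a ≠ z := fun h => hz (h ▸ ha')
  have haw : a ≠ w := fun h => hw (h ▸ ha')
  simp only [hau, hav, haz, haw, false_and, or_false, not_false_eq_true, and_true]
  exact ⟨fun h => h.2, fun h => ⟨h.ne, h⟩⟩

/-- A vertex that becomes dominated through a swap is an end of a new edge whose other end lies in
the dominating set. -/
lemma mem_undominated_of_swapGraph {G : SimpleGraph V} {u v z w : V} {T : Finset V}
    (hT : IsDominatingSet (swapGraph G u v z w) T) {x : V} (hx : x ∈ undominated G T) :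
    (x = u ∧ z ∈ T) ∨ (x = z ∧ u ∈ T) ∨ (x = v ∧ w ∈ T) ∨ (x = w ∧ v ∈ T) := by
  rw [mem_undominated] at hx
  rcases hT x with h | ⟨a, ha, hax⟩
  · exact absurd h hx.1
  rw [swapGraph_adj, Sym2.eq_iff, Sym2.eq_iff] at hax
  rcases hax.2 with h | (⟨h1, h2⟩ | ⟨h1, h2⟩) | (⟨h1, h2⟩ | ⟨h1, h2⟩)
  · exact absurd h.1.symm (hx.2 a ha)
  · exact Or.inr (Or.inl ⟨h2, h1 ▸ ha⟩)
  · exact Or.inl ⟨h2, h1 ▸ ha⟩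
  · exact Or.inr (Or.inr (Or.inr ⟨h2, h1 ▸ ha⟩))
  · exact Or.inr (Or.inr (Or.inl ⟨h2, h1 ▸ ha⟩))

/-- This is why the threshold 2 suffices for near-dominating sets: each of the two new edges rescues
at most one missed vertex, namely its end outside T. -/
lemma mem_nearDomSets_of_swapGraph {G : SimpleGraph V} {u v z w : V} {T : Finset V} {k : ℕ}
    (hT : T ∈ domSets (swapGraph G u v z w) k) : T ∈ nearDomSets G k 2 := by
  rw [mem_nearDomSets]
  refine ⟨hT.1, ?_⟩
  have hnot : ∀ x, x ∈ undominated G T → x ∉ T := fun x hx => (mem_undominated.1 hx).1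
  have hsub : undominated G T ⊆ {if u ∈ T then z else u, if v ∈ T then w else v} := by
    intro x hx
    have hxT := hnot x hx
    simp only [Finset.mem_insert, Finset.mem_singleton]
    rcases mem_undominated_of_swapGraph hT.2 hx with ⟨rfl, h⟩ | ⟨rfl, h⟩ | ⟨rfl, h⟩ | ⟨rfl, h⟩
    · left; rw [if_neg hxT]
    · left; rw [if_pos h]
    · right; rw [if_neg hxT]
    · right; rw [if_pos h]
  exact (Finset.card_le_card hsub).trans Finset.card_le_two

/-- The vertices that belong to a nearly dominating set or are left undominated by one. -/
noncomputable def nearVertices (G : SimpleGraph V) (k : ℕ) : Finset V :=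
  (nearDomSets G k 2).biUnion fun T => T ∪ undominated G T

lemma mem_nearVertices_of_mem {G : SimpleGraph V} {k : ℕ} {T : Finset V} {x : V}
    (hT : T ∈ nearDomSets G k 2) (hx : x ∈ T) : x ∈ nearVertices G k :=
  Finset.mem_biUnion.2 ⟨T, hT, Finset.mem_union_left _ hx⟩

lemma mem_nearVertices_of_undominated {G : SimpleGraph V} {k : ℕ} {T : Finset V} {x : V}
    (hT : T ∈ nearDomSets G k 2) (hx : x ∈ undominated G T) : x ∈ nearVertices G k :=
  Finset.mem_biUnion.2 ⟨T, hT, Finset.mem_union_right _ hx⟩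

lemma mem_nearDomSets_of_le {G : SimpleGraph V} {k r s : ℕ} {T : Finset V} (hrs : r ≤ s)
    (hT : T ∈ nearDomSets G k r) : T ∈ nearDomSets G k s := by
  rw [mem_nearDomSets] at hT ⊢
  exact ⟨hT.1, hT.2.trans hrs⟩

/-- All adjacency patterns of a vertex to any three vertices occur more than `s` times. -/
def PatternsOccur (s : ℕ) (G : SimpleGraph V) : Prop :=
  ∀ A P : Finset V, A.card = 3 → P ⊆ A → ∀ W : Finset V, W.card ≤ s →
    ∃ x, x ∉ W ∧ x ∉ A ∧ ∀ a ∈ A, (G.Adj x a ↔ a ∈ P)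

lemma PatternsOccur.exists_vertex {G : SimpleGraph V} {s : ℕ} (h : PatternsOccur s G) {a b c : V}
    (hab : a ≠ b) (hac : a ≠ c) (hbc : b ≠ c) (α β γ : Bool) {W : Finset V} (hW : W.card ≤ s) :
    ∃ x, x ∉ W ∧ x ≠ a ∧ x ≠ b ∧ x ≠ c ∧ (G.Adj x a ↔ α) ∧ (G.Adj x b ↔ β) ∧ (G.Adj x c ↔ γ) := by
  obtain ⟨x, hxW, hxA, hx⟩ := h {a, b, c}
    (({a, b, c} : Finset V).filter fun y => (y = a ∧ α) ∨ (y = b ∧ β) ∨ (y = c ∧ γ))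
    (by rw [Finset.card_eq_three]; exact ⟨a, b, c, hab, hac, hbc, rfl⟩)
    (Finset.filter_subset _ _) W hW
  simp only [Finset.mem_insert, Finset.mem_singleton, not_or] at hxA
  refine ⟨x, hxW, hxA.1, hxA.2.1, hxA.2.2, ?_, ?_, ?_⟩
  · rw [hx a (by simp)]; simp [hab, hac]
  · rw [hx b (by simp)]; simp [hbc, hab.symm]
  · rw [hx c (by simp)]; simp [hac.symm, hbc.symm]

/-- Removing uv takes away the only dominator of v in S, and the new neighbour w is not in S. Any
other T that became dominating would be near-dominating in G and have a rescued vertex; the rescuing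
edge has z or w as an end, so z or w would lie in T or be missed by T, which the choice of z and w
outside `nearVertices` forbids. -/
lemma swapsTo_not_hasDomSet {G : SimpleGraph V} {U S : Finset V} {k s : ℕ} {u v : V}
    (hS : S ∈ domSets G k) (huniq : ∀ T ∈ domSets G k, T = S) (hSU : Disjoint S U)
    (hu : u ∈ S) (hvU : v ∉ U) (hvS : v ∉ S) (hvu : G.Adj v u) (hpriv : ∀ a ∈ S, G.Adj v a → a = u)
    (hU : U.card + (nearVertices G k).card + 1 ≤ s) (hpat : PatternsOccur s G)
    (hV : 3 ≤ Fintype.card V) :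
    SwapsTo U G fun G' => ¬ HasDomSet G' k := by
  have huv : u ≠ v := hvu.ne.symm
  set W := U ∪ nearVertices G k with hW
  have hWc : W.card + 1 ≤ s := by
    have := Finset.card_union_le U (nearVertices G k)
    rw [hW]
    omega
  -- A dummy third vertex: patterns are formulated for triples, but z has only two constraints.
  obtain ⟨c, hc⟩ : ∃ c, c ∉ ({u, v} : Finset V) := by
    by_contra! hcon
    have h1 : (Finset.univ : Finset V) ⊆ {u, v} := fun x _ => hcon x
    have h2 := (Finset.card_le_card h1).trans Finset.card_le_two
    rw [Finset.card_univ] at h2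
    omega
  simp only [Finset.mem_insert, Finset.mem_singleton, not_or] at hc
  obtain ⟨z, hzW, hzu, hzv, -, hzu', hzv', -⟩ := hpat.exists_vertex huv (Ne.symm hc.1)
    (Ne.symm hc.2) false false false (W := W) (by omega)
  obtain ⟨w, hwW, hwu, hwv, hwz, hwu', hwv', hwz'⟩ := hpat.exists_vertex huv hzu.symm hzv.symm
    false false true (W := W) (by omega)
  simp only [Bool.false_eq_true, iff_false, iff_true] at hzu' hzv' hwu' hwv' hwz'
  have hzU : z ∉ U := fun h => hzW (Finset.mem_union_left _ h)
  have hwU : w ∉ U := fun h => hwW (Finset.mem_union_left _ h)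
  have hzN : z ∉ nearVertices G k := fun h => hzW (Finset.mem_union_right _ h)
  have hwN : w ∉ nearVertices G k := fun h => hwW (Finset.mem_union_right _ h)
  have hSN : S ∈ nearDomSets G k 2 := mem_nearDomSets_of_le (by omega) (mem_domSets_iff.1 hS)
  have hzS : z ∉ S := fun h => hzN (mem_nearVertices_of_mem hSN h)
  have hwS : w ∉ S := fun h => hwN (mem_nearVertices_of_mem hSN h)
  refine SwapsTo.of_swapGraph (Finset.disjoint_left.1 hSU hu) hvU hzU hwU ?_ hvu.symm hwz'.symm
    (fun h => hzu' h.symm) (fun h => hwu' h.symm) (fun h => hzv' h.symm) (fun h => hwv' h.symm) ?_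
  · simp [huv, hzu.symm, hzv.symm, hwu.symm, hwv.symm, hwz.symm]
  rintro ⟨T, hT⟩
  have hTN := mem_nearDomSets_of_swapGraph hT
  by_cases hTS : T = S
  · subst hTS
    rcases hT.2 v with h | ⟨a, ha, hav⟩
    · exact hvS h
    · rw [swapGraph_adj, Sym2.eq_iff, Sym2.eq_iff] at hav
      rcases hav.2 with ⟨h1, h2, -⟩ | (⟨h1, h2⟩ | ⟨h1, h2⟩) | (⟨h1, h2⟩ | ⟨h1, h2⟩)
      · exact h2 (by rw [hpriv a ha h1.symm])
      · exact hzv h2.symm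
      · exact huv h2.symm
      · exact hwv h2.symm
      · exact hwS (h1 ▸ ha)
  · have hne : (undominated G T).Nonempty := by
      rw [Finset.nonempty_iff_ne_empty]
      intro h
      exact hTS (huniq T ⟨hT.1, isDominatingSet_iff.2 h⟩)
    obtain ⟨x, hx⟩ := hne
    rcases mem_undominated_of_swapGraph hT.2 hx with ⟨rfl, h⟩ | ⟨rfl, h⟩ | ⟨rfl, h⟩ | ⟨rfl, h⟩
    · exact hzN (mem_nearVertices_of_mem hTN h)
    · exact hzN (mem_nearVertices_of_undominated hTN hx)
    · exact hwN (mem_nearVertices_of_mem hTN h)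
    · exact hwN (mem_nearVertices_of_undominated hTN hx)

/-- The new edge uz with u ∈ T₀ dominates z, while v, which loses u, keeps a second neighbour u' in
T₀. A rival T must profit from uz, as v and w avoid `nearVertices`. Either u ∈ T, and disjointness
gives T = T₀, or z ∈ T and u is the only vertex missed by T, which the choice of u excludes. -/
lemma swapsTo_hasUniqueDomSet {G : SimpleGraph V} {U T₀ : Finset V} {k s : ℕ} {z : V} (hk : 2 ≤ k)
    (hX : ¬ HasDomSet G k) (hT₀ : T₀.card = k) (hz : undominated G T₀ = {z}) (hzU : z ∉ U)
    (hTU : Disjoint T₀ U)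
    (hdisj : ∀ T ∈ nearDomSets G k 2, ∀ T' ∈ nearDomSets G k 2, T ≠ T' → Disjoint T T')
    (hU : U.card + (nearVertices G k).card + 1 ≤ s) (hpat : PatternsOccur s G) :
    SwapsTo U G fun G' => HasUniqueDomSet G' k := by
  have hT₀N : T₀ ∈ nearDomSets G k 2 := by
    rw [mem_nearDomSets, hz]
    exact ⟨hT₀, by simp⟩
  have hzT : z ∉ T₀ := (mem_undominated.1 (hz ▸ Finset.mem_singleton_self z)).1
  have hzadj : ∀ a ∈ T₀, ¬ G.Adj z a := (mem_undominated.1 (hz ▸ Finset.mem_singleton_self z)).2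
  -- By disjointness z lies in at most one near-dominating set, so at most one u is bad, and T₀ has
  -- at least two elements.
  obtain ⟨u, hu, hubad⟩ : ∃ u ∈ T₀, ∀ T' ∈ nearDomSets G k 2, z ∈ T' → undominated G T' ≠ {u} := by
    by_contra! hcon
    obtain ⟨a, ha, b, hb, hab⟩ := Finset.one_lt_card.1 (show 1 < T₀.card by omega)
    obtain ⟨T', hT', hzT', hDa⟩ := hcon a ha
    obtain ⟨T'', hT'', hzT'', hDb⟩ := hcon b hb
    by_cases h : T' = T''
    · subst h
      rw [hDa] at hDb
      exact hab (Finset.singleton_injective hDb)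
    · exact Finset.disjoint_left.1 (hdisj T' hT' T'' hT'' h) hzT' hzT''
  obtain ⟨u', hu', huu'⟩ := Finset.exists_mem_ne (show 1 < T₀.card by omega) u
  have huz : u ≠ z := fun h => hzT (h ▸ hu)
  have hu'z : u' ≠ z := fun h => hzT (h ▸ hu')
  set W := U ∪ nearVertices G k with hW
  have hWc : W.card + 1 ≤ s := by
    have := Finset.card_union_le U (nearVertices G k)
    rw [hW]
    omega
  obtain ⟨v, hvW, hvu, hvu', hvz, hvu1, hvu2, hvz1⟩ := hpat.exists_vertex huu'.symm huz hu'z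
    true true false (W := W) (by omega)
  obtain ⟨w, hwW, hwu, hwv, hwz, hwu1, hwv1, hwz1⟩ := hpat.exists_vertex hvu.symm huz hvz
    false false true (W := W) (by omega)
  simp only [Bool.false_eq_true, iff_false, iff_true] at hvu1 hvu2 hvz1 hwu1 hwv1 hwz1
  have hvU : v ∉ U := fun h => hvW (Finset.mem_union_left _ h)
  have hwU : w ∉ U := fun h => hwW (Finset.mem_union_left _ h)
  have hvN : v ∉ nearVertices G k := fun h => hvW (Finset.mem_union_right _ h)
  have hwN : w ∉ nearVertices G k := fun h => hwW (Finset.mem_union_right _ h)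
  have hvT : v ∉ T₀ := fun h => hvN (mem_nearVertices_of_mem hT₀N h)
  have hwT : w ∉ T₀ := fun h => hwN (mem_nearVertices_of_mem hT₀N h)
  refine SwapsTo.of_swapGraph (Finset.disjoint_left.1 hTU hu) hvU hzU hwU ?_ hvu1.symm hwz1.symm
    (fun h => hzadj u hu h.symm) (fun h => hwu1 h.symm) hvz1 (fun h => hwv1 h.symm) ?_
  · simp [hvu.symm, huz, hwu.symm, hvz, hwv.symm, hwz.symm]
  refine ⟨T₀, ⟨hT₀, fun x => ?_⟩, fun T hT => ?_⟩
  · by_cases hxT : x ∈ T₀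
    · exact Or.inl hxT
    right
    by_cases hxz : x = z
    · subst hxz
      exact ⟨u, hu, swapGraph_adj.2 ⟨huz, Or.inr (Or.inl rfl)⟩⟩
    by_cases hxv : x = v
    · subst hxv
      refine ⟨u', hu', swapGraph_adj.2 ⟨hvu'.symm, Or.inl ⟨hvu2.symm, ?_, ?_⟩⟩⟩
      · rw [ne_eq, Sym2.eq_iff]
        rintro (⟨h, -⟩ | ⟨h, -⟩)
        · exact huu' h
        · exact hvu' h.symm
      · rw [ne_eq, Sym2.eq_iff]
        rintro (⟨h, -⟩ | ⟨h, -⟩)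
        · exact hu'z h
        · exact hwT (h ▸ hu')
    have hxD : x ∉ undominated G T₀ := by
      rw [hz]; simpa using hxz
    rw [mem_undominated] at hxD
    push Not at hxD
    obtain ⟨a, ha, hxa⟩ := hxD hxT
    refine ⟨a, ha, swapGraph_adj.2 ⟨hxa.ne.symm, Or.inl ⟨hxa.symm, ?_, ?_⟩⟩⟩
    · rw [ne_eq, Sym2.eq_iff]
      rintro (⟨-, h⟩ | ⟨h, -⟩)
      · exact hxv h
      · exact hvT (h ▸ ha)
    · rw [ne_eq, Sym2.eq_iff]
      rintro (⟨h, -⟩ | ⟨h, -⟩)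
      · exact hzT (h ▸ ha)
      · exact hwT (h ▸ ha)
  · have hTN := mem_nearDomSets_of_swapGraph hT
    have hcases : ∀ x ∈ undominated G T, (x = u ∧ z ∈ T) ∨ (x = z ∧ u ∈ T) := by
      intro x hx
      rcases mem_undominated_of_swapGraph hT.2 hx with h | h | ⟨rfl, h⟩ | ⟨rfl, h⟩
      · exact Or.inl h
      · exact Or.inr h
      · exact absurd (mem_nearVertices_of_undominated hTN hx) hvN
      · exact absurd (mem_nearVertices_of_undominated hTN hx) hwN
    have hne : (undominated G T).Nonempty := by
      rw [Finset.nonempty_iff_ne_empty]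
      intro h
      exact hX ⟨T, hT.1, isDominatingSet_iff.2 h⟩
    obtain ⟨x, hx⟩ := hne
    have huT : u ∈ T := by
      rcases hcases x hx with ⟨rfl, h⟩ | ⟨-, h⟩
      · exfalso
        refine hubad T hTN h (Finset.eq_singleton_iff_unique_mem.2 ⟨hx, fun y hy => ?_⟩)
        rcases hcases y hy with ⟨h', -⟩ | ⟨rfl, -⟩
        · exact h'
        · exact absurd h (mem_undominated.1 hy).1
      · exact h
    by_contra hTT
    exact Finset.disjoint_left.1 (hdisj T hTN T₀ hT₀N hTT) huT hu

end SymmetrySwap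

/-! ### First and second moments of the number of near-dominating sets. -/

section MomentBounds

variable {V : Type*} [Fintype V] [DecidableEq V]

lemma real_exists_le {β : Type*} (p : I) (S : Finset β) (E : β → SimpleGraph V → Prop) :
    G(V, p).real {G | ∃ b ∈ S, E b G} ≤ ∑ b ∈ S, G(V, p).real {G | E b G} := by
  have h : {G : SimpleGraph V | ∃ b ∈ S, E b G} = ⋃ b ∈ S, {G | E b G} := by
    ext G; simp
  rw [h]
  exact measureReal_biUnion_finset_le S _

lemma real_exists_le_card_mul {β : Type*} (p : I) (S : Finset β) (E : β → SimpleGraph V → Prop)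
    (c : ℝ) (h : ∀ b ∈ S, G(V, p).real {G | E b G} ≤ c) :
    G(V, p).real {G | ∃ b ∈ S, E b G} ≤ S.card * c := by
  refine (real_exists_le p S E).trans ((Finset.sum_le_sum h).trans ?_)
  simp

lemma real_or_le (p : I) (P Q : SimpleGraph V → Prop) :
    G(V, p).real {G | P G ∨ Q G} ≤ G(V, p).real {G | P G} + G(V, p).real {G | Q G} :=
  measureReal_union_le _ _

lemma real_not (p : I) (P : SimpleGraph V → Prop) :
    G(V, p).real {G | ¬ P G} = 1 - G(V, p).real {G | P G} :=
  probReal_compl_eq_one_sub (μ := G(V, p)) (s := {G | P G}) MeasurableSet.of_discrete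

lemma card_nearDomSets_eq_sum (G : SimpleGraph V) (k r : ℕ) :
    ((nearDomSets G k r).card : ℝ) = ∑ T ∈ (Finset.univ : Finset V).powersetCard k,
      if (undominated G T).card ≤ r then (1 : ℝ) else 0 := by
  simp [nearDomSets]

lemma integral_card_nearDomSets (p : I) (k r : ℕ) :
    ∫ G, ((nearDomSets G k r).card : ℝ) ∂G(V, p) = ((Fintype.card V).choose k : ℝ) *
      binomialCdf (Fintype.card V - k) ((1 - p : ℝ) ^ k) r := by
  simp only [card_nearDomSets_eq_sum]
  rw [integral_finsetSum _ fun _ _ => Integrable.of_finite]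
  rw [← Finset.card_univ (α := V), ← Finset.card_powersetCard, ← nsmul_eq_mul, ← Finset.sum_const]
  refine Finset.sum_congr rfl fun T hT => ?_
  rw [← real_eq_integral_ite, real_undominated_card_le, (Finset.mem_powersetCard.1 hT).2]
  rfl

lemma expectedDomSets_eq (n k : ℕ) (p : I) :
    expectedDomSets n k p = (n.choose k : ℝ) * (1 - (1 - p : ℝ) ^ k) ^ (n - k) := by
  have h := integral_card_nearDomSets (V := Fin n) p k 0
  rw [binomialCdf_zero, Fintype.card_fin] at h
  rw [← h, expectedDomSets]
  congr 1
  ext G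
  rw [domSets_eq, Set.ncard_coe_finset]

/-- Bound for the probability that a given `k`-set leaves at most two vertices undominated. -/
noncomputable def nearBound (N k : ℕ) (q t : ℝ) : ℝ := (t ^ 2)⁻¹ * (1 - (1 - t) * q ^ k) ^ (N - k)

lemma real_near_le (p : I) {k r : ℕ} (hr : r ≤ 2) {t : ℝ} (ht : 0 < t) (ht1 : t ≤ 1) {T : Finset V}
    (hT : T.card = k) : G(V, p).real {G | (undominated G T).card ≤ r} ≤
      nearBound (Fintype.card V) k (1 - p) t := by
  have h := real_undominated_card_le_tilt p T 2 ht ht1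
  rw [hT] at h
  exact (real_mono fun G hG => le_trans hG hr).trans h

lemma nearBound_nonneg (p : I) (N k : ℕ) {t : ℝ} (ht : 0 < t) :
    0 ≤ nearBound N k (1 - p) t := by
  have hp : 0 ≤ (1 - p : ℝ) := sub_nonneg.2 p.2.2
  have h1 : (1 - p : ℝ) ^ k ≤ 1 := pow_le_one₀ hp (by linarith [p.2.1])
  have h0 : 0 ≤ (1 - p : ℝ) ^ k := pow_nonneg hp _
  have : 0 ≤ 1 - (1 - t) * (1 - p : ℝ) ^ k := by nlinarith
  unfold nearBound
  positivity

/-- Union bound over x ∈ U and the k-sets through x; for |U| ≤ n^c the loss against the first moment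
over all k-sets is a factor |U|k/n. -/
lemma real_near_meets_le (p : I) {k : ℕ} {t : ℝ} (ht : 0 < t) (ht1 : t ≤ 1)
    (U : Finset V) :
    G(V, p).real {G | ∃ T ∈ nearDomSets G k 2, ¬ Disjoint T U} ≤
      U.card * ((Fintype.card V - 1).choose (k - 1) * nearBound (Fintype.card V) k (1 - p) t) := by
  classical
  have hcount : ∀ x : V, (((Finset.univ : Finset V).powersetCard k).filter fun T => x ∈ T).card ≤
      (Fintype.card V - 1).choose (k - 1) := by
    intro x
    have h1 : (Fintype.card V - 1).choose (k - 1) =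
        (((Finset.univ : Finset V).erase x).powersetCard (k - 1)).card := by
      rw [Finset.card_powersetCard, Finset.card_erase_of_mem (Finset.mem_univ x), Finset.card_univ]
    rw [h1]
    refine Finset.card_le_card_of_injOn (fun T => T.erase x) ?_ ?_
    · intro T hT
      simp only [Finset.coe_filter, Set.mem_ofPred_eq, Finset.mem_powersetCard] at hT
      rw [Finset.mem_coe, Finset.mem_powersetCard]
      refine ⟨Finset.erase_subset_erase _ hT.1.1, ?_⟩
      rw [Finset.card_erase_of_mem hT.2, hT.1.2]
    · intro T hT T' hT' h
      simp only [Finset.coe_filter, Set.mem_ofPred_eq] at hT hT'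
      have h' : T.erase x = T'.erase x := h
      rw [← Finset.insert_erase hT.2, ← Finset.insert_erase hT'.2, h']
  calc G(V, p).real {G | ∃ T ∈ nearDomSets G k 2, ¬ Disjoint T U}
      ≤ G(V, p).real {G | ∃ x ∈ U, ∃ T ∈ ((Finset.univ : Finset V).powersetCard k).filter
          (fun T => x ∈ T), (undominated G T).card ≤ 2} := by
        refine real_mono fun G hG => ?_
        obtain ⟨T, hT, hTU⟩ := hG
        obtain ⟨x, hxT, hxU⟩ := Finset.not_disjoint_iff.1 hTU
        rw [mem_nearDomSets] at hT
        exact ⟨x, hxU, T, by simp [hxT, hT.1], hT.2⟩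
    _ ≤ _ := by
        refine real_exists_le_card_mul p U _ _ fun x _ => ?_
        refine (real_exists_le_card_mul p _ _ (nearBound (Fintype.card V) k (1 - p) t)
          fun T hT => ?_).trans ?_
        · simp only [Finset.mem_filter, Finset.mem_powersetCard] at hT
          exact real_near_le p le_rfl ht ht1 hT.1.2
        · have := nearBound_nonneg p (Fintype.card V) k ht
          gcongr
          exact hcount x

lemma integral_card_near_le (p : I) {k : ℕ} {t : ℝ} (ht : 0 < t) (ht1 : t ≤ 1) :
    ∫ G, ((nearDomSets G k 2).card : ℝ) ∂G(V, p) ≤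
      ((Fintype.card V).choose k : ℝ) * nearBound (Fintype.card V) k (1 - p) t := by
  simp only [card_nearDomSets_eq_sum]
  rw [integral_finsetSum _ fun _ _ => Integrable.of_finite]
  rw [← Finset.card_univ (α := V), ← Finset.card_powersetCard, ← nsmul_eq_mul, ← Finset.sum_const]
  refine Finset.sum_le_sum fun T hT => ?_
  rw [← real_eq_integral_ite]
  exact real_near_le p le_rfl ht ht1 (Finset.mem_powersetCard.1 hT).2

lemma card_nearVertices_le (G : SimpleGraph V) (k : ℕ) :
    (nearVertices G k).card ≤ (nearDomSets G k 2).card * (k + 2) := by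
  refine Finset.card_biUnion_le_card_mul _ _ _ fun T hT => ?_
  rw [mem_nearDomSets] at hT
  exact (Finset.card_union_le _ _).trans (by omega)

lemma real_card_nearVertices_ge_le (p : I) {k : ℕ} {t : ℝ} (ht : 0 < t) (ht1 : t ≤ 1) {s : ℝ}
    (hs : 0 < s) :
    G(V, p).real {G | s ≤ (nearVertices G k).card} ≤
      (k + 2) * (((Fintype.card V).choose k : ℝ) * nearBound (Fintype.card V) k (1 - p) t) / s := by
  classical
  rw [le_div_iff₀ hs, real_eq_integral_ite, ← integral_mul_const]
  calc ∫ G, (if s ≤ (nearVertices G k).card then (1 : ℝ) else 0) * s ∂G(V, p)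
      ≤ ∫ G, ((k : ℝ) + 2) * ((nearDomSets G k 2).card : ℝ) ∂G(V, p) := by
        refine integral_mono Integrable.of_finite Integrable.of_finite fun G => ?_
        have h : ((nearVertices G k).card : ℝ) ≤ ((nearDomSets G k 2).card : ℝ) * (k + 2) := by
          exact_mod_cast card_nearVertices_le G k
        dsimp only
        split_ifs with h1
        · linarith
        · have : (0 : ℝ) ≤ ((k : ℝ) + 2) * ((nearDomSets G k 2).card : ℝ) := by positivity
          linarith
    _ ≤ _ := by
        rw [integral_const_mul]
        gcongr
        exact integral_card_near_le p ht ht1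

/-- Bound for the expected number of pairs of intersecting nearly dominating `k`-sets. -/
noncomputable def pairBound (N k : ℕ) (q t : ℝ) : ℝ :=
  ∑ i ∈ Finset.Ico 1 k, (N.choose k : ℝ) * ((k.choose i * N.choose (k - i) : ℕ) : ℝ) *
    ((t ^ 4)⁻¹ * (1 - (1 - t) * (2 * q ^ k - q ^ (2 * k - i))) ^ (N - 2 * k))

/-- T' is recovered from the pair (T ∩ T', T' \ T); the second part is counted as an arbitrary
subset of V. -/
lemma card_filter_inter_le (T : Finset V) (k i : ℕ) (hT : T.card = k) :
    (((Finset.univ : Finset V).powersetCard k).filter fun T' => (T ∩ T').card = i).card ≤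
      k.choose i * (Fintype.card V).choose (k - i) := by
  have h1 : k.choose i * (Fintype.card V).choose (k - i) =
      (T.powersetCard i ×ˢ (Finset.univ : Finset V).powersetCard (k - i)).card := by
    rw [Finset.card_product, Finset.card_powersetCard, Finset.card_powersetCard, hT,
      Finset.card_univ]
  rw [h1]
  refine Finset.card_le_card_of_injOn (fun T' => (T ∩ T', T' \ T)) ?_ ?_
  · intro T' hT'
    simp only [Finset.coe_filter, Set.mem_ofPred_eq, Finset.mem_powersetCard] at hT'
    simp only [Finset.coe_product, Set.mem_prod, Finset.mem_coe, Finset.mem_powersetCard]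
    refine ⟨⟨Finset.inter_subset_left, hT'.2⟩, Finset.subset_univ _, ?_⟩
    rw [Finset.card_sdiff, hT'.2, hT'.1.2]
  · intro T' _ T'' _ h
    simp only [Prod.mk.injEq] at h
    rw [← Finset.sdiff_union_inter T' T, ← Finset.sdiff_union_inter T'' T, Finset.inter_comm T' T,
      Finset.inter_comm T'' T, h.1, h.2]

lemma pair_base_nonneg (p : I) (k i : ℕ) {t : ℝ} (ht : 0 < t) (hik : i ≤ k) :
    0 ≤ 1 - (1 - t) * (2 * (1 - p : ℝ) ^ k - (1 - p : ℝ) ^ (2 * k - i)) := by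
  have hp : 0 ≤ (1 - p : ℝ) := sub_nonneg.2 p.2.2
  have hp1 : (1 - p : ℝ) ≤ 1 := by linarith [p.2.1]
  have h1 : (1 - p : ℝ) ^ k ≤ 1 := pow_le_one₀ hp hp1
  have h0 : 0 ≤ (1 - p : ℝ) ^ k := pow_nonneg hp _
  have h2 : ((1 - p : ℝ) ^ k) ^ 2 ≤ (1 - p : ℝ) ^ (2 * k - i) := by
    rw [← pow_mul]
    exact pow_le_pow_of_le_one hp hp1 (by omega)
  have h3 : (1 - p : ℝ) ^ (2 * k - i) ≤ (1 - p : ℝ) ^ k :=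
    pow_le_pow_of_le_one hp hp1 (by omega)
  have h4 : 2 * (1 - p : ℝ) ^ k - (1 - p : ℝ) ^ (2 * k - i) ≤ 1 := by
    nlinarith [sq_nonneg (1 - (1 - p : ℝ) ^ k)]
  nlinarith

open scoped Classical in
lemma sum_intersecting_pairs_le (p : I) {k r : ℕ} (hr : r ≤ 2) {t : ℝ} (ht : 0 < t)
    (ht1 : t ≤ 1) :
    ∑ T ∈ (Finset.univ : Finset V).powersetCard k,
      ∑ T' ∈ ((Finset.univ : Finset V).powersetCard k).filter fun T' => T' ≠ T ∧ ¬ Disjoint T T',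
        G(V, p).real {G | (undominated G T).card ≤ r ∧ (undominated G T').card ≤ r} ≤
      pairBound (Fintype.card V) k (1 - p) t := by
  set q : ℝ := 1 - p with hq
  set h : ℕ → ℝ := fun i => (t ^ 4)⁻¹ *
    (1 - (1 - t) * (2 * q ^ k - q ^ (2 * k - i))) ^ (Fintype.card V - 2 * k) with hh
  have hh0 : ∀ i ≤ k, 0 ≤ h i := by
    intro i hi
    have := pair_base_nonneg p k i ht hi
    simp only [hh]
    positivity
  have hinner : ∀ T ∈ (Finset.univ : Finset V).powersetCard k,
      ∑ T' ∈ ((Finset.univ : Finset V).powersetCard k).filter fun T' => T' ≠ T ∧ ¬ Disjoint T T',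
        G(V, p).real {G | (undominated G T).card ≤ r ∧ (undominated G T').card ≤ r} ≤
      ∑ i ∈ Finset.Ico 1 k, ((k.choose i * (Fintype.card V).choose (k - i) : ℕ) : ℝ) * h i := by
    intro T hT
    have hTk : T.card = k := (Finset.mem_powersetCard.1 hT).2
    calc _ ≤ ∑ T' ∈ ((Finset.univ : Finset V).powersetCard k).filter
          fun T' => T' ≠ T ∧ ¬ Disjoint T T', h (T ∩ T').card := by
          refine Finset.sum_le_sum fun T' hT' => ?_
          simp only [Finset.mem_filter, Finset.mem_powersetCard] at hT'
          exact (real_mono fun G hG => ⟨hG.1.trans hr, hG.2.trans hr⟩).trans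
            (real_undominated_pair_tilt p hTk hT'.1.2 rfl 2 ht ht1)
      _ = ∑ i ∈ Finset.Ico 1 k, ∑ T' ∈ (((Finset.univ : Finset V).powersetCard k).filter
          fun T' => T' ≠ T ∧ ¬ Disjoint T T') with (T ∩ T').card = i, h (T ∩ T').card := by
          refine (Finset.sum_fiberwise_of_maps_to (fun T' hT' => ?_) _).symm
          simp only [Finset.mem_filter, Finset.mem_powersetCard] at hT'
          rw [Finset.mem_Ico]
          constructor
          · rw [Nat.one_le_iff_ne_zero, Finset.card_ne_zero, Finset.nonempty_iff_ne_empty]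
            exact fun h => hT'.2.2 (Finset.disjoint_iff_inter_eq_empty.2 h)
          · by_contra! hcon
            have h1 : T ∩ T' = T := Finset.eq_of_subset_of_card_le Finset.inter_subset_left
              (by omega)
            have h2 : T ∩ T' = T' := Finset.eq_of_subset_of_card_le Finset.inter_subset_right
              (by omega)
            exact hT'.2.1 (h2.symm.trans h1)
      _ ≤ _ := by
          refine Finset.sum_le_sum fun i hi => ?_
          have hi0 := hh0 i (Finset.mem_Ico.1 hi).2.le
          calc _ = ∑ T' ∈ (((Finset.univ : Finset V).powersetCard k).filter
                fun T' => T' ≠ T ∧ ¬ Disjoint T T') with (T ∩ T').card = i, h i :=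
                Finset.sum_congr rfl fun T' hT' => by rw [(Finset.mem_filter.1 hT').2]
            _ ≤ _ := by
                rw [Finset.sum_const, nsmul_eq_mul]
                gcongr
                refine (Finset.card_le_card ?_).trans (card_filter_inter_le T k i hTk)
                intro T' hT'
                simp only [Finset.mem_filter] at hT' ⊢
                exact ⟨hT'.1.1, hT'.2⟩
  refine (Finset.sum_le_sum hinner).trans ?_
  rw [Finset.sum_const, Finset.card_powersetCard, Finset.card_univ, nsmul_eq_mul, Finset.mul_sum]
  unfold pairBound
  refine Finset.sum_le_sum fun i _ => le_of_eq ?_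
  rw [mul_assoc]

lemma real_near_intersect_le (p : I) {k : ℕ} {t : ℝ} (ht : 0 < t) (ht1 : t ≤ 1) :
    G(V, p).real {G | ∃ T ∈ nearDomSets G k 2, ∃ T' ∈ nearDomSets G k 2, T ≠ T' ∧
      ¬ Disjoint T T'} ≤ pairBound (Fintype.card V) k (1 - p) t := by
  classical
  refine le_trans ?_ (sum_intersecting_pairs_le p le_rfl ht ht1)
  refine le_trans ?_ ((real_exists_le p _ (fun T G => ∃ T' ∈ ((Finset.univ : Finset V).powersetCard
    k).filter (fun T' => T' ≠ T ∧ ¬ Disjoint T T'), (undominated G T).card ≤ 2 ∧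
      (undominated G T').card ≤ 2)).trans (Finset.sum_le_sum fun T _ => real_exists_le p _ _))
  refine real_mono fun G hG => ?_
  obtain ⟨T, hT, T', hT', hne, hd⟩ := hG
  rw [mem_nearDomSets] at hT hT'
  exact ⟨T, by simp [hT.1], T', by simp [hT'.1, hne.symm, hd], hT.2, hT'.2⟩

/-- Second factorial moment of the number of `k`-sets with at most `r` undominated vertices. -/
lemma integral_card_sq_sub_le (p : I) {k r : ℕ} (hr : r ≤ 2) {t : ℝ} (ht : 0 < t) (ht1 : t ≤ 1)
    (hy : (1 - p : ℝ) ^ k < 1) :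
    ∫ G, (((nearDomSets G k r).card : ℝ) ^ 2 - (nearDomSets G k r).card) ∂G(V, p) ≤
      pairBound (Fintype.card V) k (1 - p) t + (((Fintype.card V).choose k : ℝ) *
        binomialCdf (Fintype.card V - k) ((1 - p : ℝ) ^ k) r) ^ 2 *
          ((1 - (1 - p : ℝ) ^ k) ^ (2 * k))⁻¹ := by
  classical
  set K := (Finset.univ : Finset V).powersetCard k with hK
  set π := binomialCdf (Fintype.card V - k) ((1 - p : ℝ) ^ k) r
  -- X² - X counts ordered pairs of distinct sets.
  have hpt : ∀ G : SimpleGraph V, ((nearDomSets G k r).card : ℝ) ^ 2 - (nearDomSets G k r).card =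
      ∑ T ∈ K, ∑ T' ∈ K.filter (fun T' => T' ≠ T),
        if ((undominated G T).card ≤ r ∧ (undominated G T').card ≤ r) then (1 : ℝ) else 0 := by
    intro G
    rw [card_nearDomSets_eq_sum, sq, Finset.sum_mul_sum, ← Finset.sum_sub_distrib]
    refine Finset.sum_congr rfl fun T hT => ?_
    rw [sub_eq_iff_eq_add, Finset.filter_ne', ← Finset.sum_erase_add _ _ hT]
    congr 1
    · refine Finset.sum_congr rfl fun T' _ => ?_
      by_cases h1 : (undominated G T).card ≤ r <;> by_cases h2 : (undominated G T').card ≤ r <;>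
        simp [h1, h2]
    · split_ifs <;> simp
  simp only [hpt]
  rw [integral_finsetSum _ fun _ _ => Integrable.of_finite]
  have hin : ∀ T ∈ K, ∫ G, ∑ T' ∈ K.filter (fun T' => T' ≠ T),
        (if ((undominated G T).card ≤ r ∧ (undominated G T').card ≤ r) then (1 : ℝ) else 0)
          ∂G(V, p) ≤
      ∑ T' ∈ K.filter (fun T' => T' ≠ T ∧ ¬ Disjoint T T'),
        G(V, p).real {G | (undominated G T).card ≤ r ∧ (undominated G T').card ≤ r} +
      K.card * (π ^ 2 * ((1 - (1 - p : ℝ) ^ k) ^ (2 * k))⁻¹) := by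
    intro T hT
    have hTk : T.card = k := (Finset.mem_powersetCard.1 hT).2
    rw [integral_finsetSum _ fun _ _ => Integrable.of_finite]
    simp only [← real_eq_integral_ite]
    -- Intersecting pairs go into `pairBound`; disjoint pairs are nearly independent and contribute
    -- the square of the mean up to a factor close to 1.
    rw [← Finset.sum_filter_add_sum_filter_not (K.filter fun T' => T' ≠ T)
      (fun T' => ¬ Disjoint T T'), Finset.filter_filter]
    gcongr ?_ + ?_
    · exact le_of_eq (Finset.sum_congr rfl fun _ _ => rfl)
    · rw [← nsmul_eq_mul]
      refine (Finset.sum_le_card_nsmul _ _ (π ^ 2 * ((1 - (1 - p : ℝ) ^ k) ^ (2 * k))⁻¹)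
        fun T' hT' => ?_).trans ?_
      · simp only [Finset.mem_filter, not_not] at hT'
        exact real_undominated_disjoint_pair p hT'.2 hTk (Finset.mem_powersetCard.1 hT'.1.1).2 r hy
      · have : 0 < (1 - (1 - p : ℝ) ^ k) := by linarith
        refine nsmul_le_nsmul_left (by positivity) (Finset.card_le_card ?_)
        exact (Finset.filter_subset _ _).trans (Finset.filter_subset _ _)
  refine (Finset.sum_le_sum hin).trans ?_
  rw [Finset.sum_add_distrib, Finset.sum_const, nsmul_eq_mul]
  refine add_le_add (sum_intersecting_pairs_le p hr ht ht1) (le_of_eq ?_)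
  rw [hK, Finset.card_powersetCard, Finset.card_univ]
  ring

end MomentBounds

/-! ### Probabilities of the exceptional events, and the error of local decisions. -/

section RareEvents

variable {V : Type*} [Fintype V] [DecidableEq V]

lemma real_undominated_singleton_meets_le (p : I) (k : ℕ) (U : Finset V) :
    G(V, p).real {G | ∃ T : Finset V, T.card = k ∧ ∃ z ∈ U, undominated G T = {z}} ≤
      U.card * (((Fintype.card V).choose k : ℝ) *
        ((1 - p : ℝ) ^ k * (1 - (1 - p : ℝ) ^ k) ^ (Fintype.card V - k - 1))) := by
  classical
  have hp : 0 ≤ (1 - p : ℝ) := sub_nonneg.2 p.2.2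
  have h1 : (1 - p : ℝ) ^ k ≤ 1 := pow_le_one₀ hp (by linarith [p.2.1])
  have h0 : 0 ≤ (1 - p : ℝ) ^ k := pow_nonneg hp _
  calc _ ≤ G(V, p).real {G | ∃ z ∈ U, ∃ T ∈ (Finset.univ : Finset V).powersetCard k,
          undominated G T = {z}} := by
        refine real_mono fun G hG => ?_
        obtain ⟨T, hT, z, hz, h⟩ := hG
        exact ⟨z, hz, T, by simp [hT], h⟩
    _ ≤ _ := by
        refine real_exists_le_card_mul p U _ _ fun z _ => ?_
        refine (real_exists_le_card_mul p _ _ _ fun T hT => ?_).trans (le_of_eq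
          (by rw [Finset.card_powersetCard, Finset.card_univ]))
        rw [Finset.mem_powersetCard] at hT
        by_cases hz : z ∈ T
        · have : {G : SimpleGraph V | undominated G T = {z}} = ∅ := by
            ext G
            simp only [Set.mem_ofPred_eq, Set.mem_empty_iff_false, iff_false]
            intro h
            exact (mem_undominated.1 (h ▸ Finset.mem_singleton_self z)).1 hz
          rw [this, measureReal_empty]
          have : 0 ≤ 1 - (1 - p : ℝ) ^ k := by linarith
          positivity
        · rw [real_undominated_eq_singleton p T hz, hT.2]

/-- `v` is a vertex outside `S` whose only neighbour in `S` is `u`. -/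
def IsPrivateNeighbor (G : SimpleGraph V) (S : Finset V) (u v : V) : Prop :=
  v ∉ S ∧ G.Adj v u ∧ ∀ a ∈ S, G.Adj v a → a = u

/-- As S dominates, a vertex outside S with no neighbour in S \ {u} must be adjacent to u, hence is
a private neighbour. So it is enough to bound the probability that every vertex outside S ∪ U sees S
\ {u}; that S dominates is then dropped. -/
lemma real_no_private_neighbor_le (p : I) {k : ℕ} (hk : 1 ≤ k) (U : Finset V) :
    G(V, p).real {G | ∃ S ∈ domSets G k, Disjoint S U ∧
      ∃ u ∈ S, ∀ v ∉ U, ¬ IsPrivateNeighbor G S u v} ≤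
      ((Fintype.card V).choose k : ℝ) * (k *
        (1 - (1 - p : ℝ) ^ (k - 1)) ^ (Fintype.card V - k - U.card)) := by
  classical
  have hp : 0 ≤ (1 - p : ℝ) := sub_nonneg.2 p.2.2
  have h1 : (1 - p : ℝ) ^ (k - 1) ≤ 1 := pow_le_one₀ hp (by linarith [p.2.1])
  have h2 : 0 ≤ 1 - (1 - p : ℝ) ^ (k - 1) := by linarith
  calc _ ≤ G(V, p).real {G | ∃ S ∈ ((Finset.univ : Finset V).powersetCard k).filter
          (fun S => Disjoint S U), ∃ u ∈ S, ∀ v ∈ (S ∪ U)ᶜ, ¬ NoNeighborIn (S.erase u) v G} := by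
        refine real_mono fun G hG => ?_
        obtain ⟨S, hS, hSU, u, hu, h⟩ := hG
        refine ⟨S, by simp [hS.1, hSU], u, hu, fun v hv hno => ?_⟩
        simp only [Finset.mem_compl, Finset.mem_union, not_or] at hv
        have hpriv : ∀ a ∈ S, G.Adj v a → a = u := fun a ha hva => by
          by_contra hau
          exact hno a (Finset.mem_erase.2 ⟨hau, ha⟩) hva
        refine h v hv.2 ⟨hv.1, ?_, hpriv⟩
        rcases hS.2 v with h' | ⟨a, ha, hav⟩
        · exact absurd h' hv.1
        · rw [← hpriv a ha hav.symm]; exact hav.symm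
    _ ≤ _ := by
        refine (real_exists_le_card_mul p _ _ (k *
          (1 - (1 - p : ℝ) ^ (k - 1)) ^ (Fintype.card V - k - U.card)) fun S hS => ?_).trans ?_
        · simp only [Finset.mem_filter, Finset.mem_powersetCard] at hS
          rw [← hS.1.2]
          refine real_exists_le_card_mul p S _ _ fun u hu => le_of_eq ?_
          have hdisj : Disjoint (S.erase u) (S ∪ U)ᶜ := disjoint_compl_right.mono_left
            ((Finset.erase_subset _ _).trans Finset.subset_union_left)
          rw [real_none p _ (starEdges (S.erase u)) (NoNeighborIn (S.erase u))
            (pairwiseDisjoint_starEdges hdisj) (fun x _ => determinedBy_noNeighborIn _ x) _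
            (fun x hx => real_noNeighborIn p _ (Finset.disjoint_right.1 hdisj hx)),
            Finset.card_erase_of_mem hu, Finset.card_compl, Finset.card_union_of_disjoint hS.2,
            Nat.sub_add_eq]
        · have h3 : (((Finset.univ : Finset V).powersetCard k).filter
              fun S => Disjoint S U).card ≤ (Fintype.card V).choose k := by
            rw [← Finset.card_univ, ← Finset.card_powersetCard]
            exact Finset.card_filter_le _ _
          gcongr

/-- A failure means that W contains every vertex with some pattern on some triple, so that at most s
vertices show it. A union bound over triples and the 8 patterns, with exponential Markov, finishes.
-/
lemma real_not_patternsOccur_le (p : I) (s : ℕ) {η t : ℝ} (hη : 0 ≤ η) (hηp : η ≤ p)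
    (hηq : η ≤ 1 - p) (ht : 0 < t) (ht1 : t ≤ 1) :
    G(V, p).real {G | ¬ PatternsOccur s G} ≤
      ((Fintype.card V).choose 3 : ℝ) * (8 * ((t ^ s)⁻¹ *
        (1 - (1 - t) * η ^ 3) ^ (Fintype.card V - 3))) := by
  classical
  calc _ ≤ G(V, p).real {G | ∃ A ∈ (Finset.univ : Finset V).powersetCard 3, ∃ P ∈ A.powerset,
          (Aᶜ.filter fun x => ∀ a ∈ A, (G.Adj x a ↔ a ∈ P)).card ≤ s} := by
        refine real_mono fun G hG => ?_
        unfold PatternsOccur at hG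
        push Not at hG
        obtain ⟨A, P, hA, hPA, W, hW, h⟩ := hG
        refine ⟨A, by simp [hA], P, by simpa using hPA, (Finset.card_le_card ?_).trans hW⟩
        intro x hx
        simp only [Finset.mem_filter, Finset.mem_compl] at hx
        by_contra hxW
        obtain ⟨a, ha, h'⟩ := h x hxW hx.1
        have := hx.2 a ha
        tauto
    _ ≤ _ := by
        refine (real_exists_le_card_mul p _ _ _ fun A hA => ?_).trans (le_of_eq
          (by rw [Finset.card_powersetCard, Finset.card_univ]))
        rw [Finset.mem_powersetCard] at hA
        refine (real_exists_le_card_mul p _ _ _ fun P hP => ?_).trans (le_of_eq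
          (by rw [Finset.card_powerset, hA.2]; norm_num; rfl))
        have hprod : η ^ 3 ≤ ∏ a ∈ A, (if a ∈ P then (p : ℝ) else 1 - p) := by
          rw [← hA.2, ← Finset.prod_const]
          exact Finset.prod_le_prod (fun _ _ => hη) fun a _ => by split_ifs <;> assumption
        have hprod1 : ∏ a ∈ A, (if a ∈ P then (p : ℝ) else 1 - p) ≤ 1 := by
          refine Finset.prod_le_one (fun a _ => ?_) (fun a _ => ?_)
          · split_ifs <;> linarith
          · split_ifs <;> linarith
        have h := real_card_le p Aᶜ (starEdges A) (fun x G => ∀ a ∈ A, (G.Adj x a ↔ a ∈ P))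
          (pairwiseDisjoint_starEdges disjoint_compl_right) (fun x _ => by
            apply determinedBy_starEdges
            intro G G' hG
            exact propext (forall₂_congr fun a ha => by rw [hG a ha])) _ t ht ht1
          (fun x hx => real_pattern p A P (by simpa using hx)) s
        rw [Finset.card_compl, hA.2] at h
        refine le_trans ?_ (h.trans ?_)
        · exact real_mono fun G hG => by convert hG
        · have hb0 : 0 ≤ 1 - (1 - t) * ∏ a ∈ A, (if a ∈ P then (p : ℝ) else 1 - p) := by
            nlinarith [pow_nonneg hη 3]
          gcongr

lemma real_hasDomSet_le (p : I) (k : ℕ) :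
    G(V, p).real {G | HasDomSet G k} ≤
      ((Fintype.card V).choose k : ℝ) * (1 - (1 - p : ℝ) ^ k) ^ (Fintype.card V - k) := by
  classical
  rw [← binomialCdf_zero, ← integral_card_nearDomSets, real_eq_integral_ite]
  refine integral_mono Integrable.of_finite Integrable.of_finite fun G => ?_
  dsimp only
  split_ifs with h
  · obtain ⟨S, hS⟩ := h
    rw [mem_domSets_iff] at hS
    exact_mod_cast Finset.card_pos.2 ⟨S, hS⟩
  · positivity

/-- Take expectations in the pointwise bound X - (X² - X) ≤ 1[X = 1], whose left side is not
positive unless X = 1. -/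
lemma le_real_hasUniqueDomSet (p : I) {k : ℕ} {t : ℝ} (ht : 0 < t) (ht1 : t ≤ 1)
    (hy : (1 - p : ℝ) ^ k < 1) {μ : ℝ}
    (hμ : μ = ((Fintype.card V).choose k : ℝ) * (1 - (1 - p : ℝ) ^ k) ^ (Fintype.card V - k)) :
    μ - (pairBound (Fintype.card V) k (1 - p) t + μ ^ 2 * ((1 - (1 - p : ℝ) ^ k) ^ (2 * k))⁻¹) ≤
      G(V, p).real {G | HasUniqueDomSet G k} := by
  classical
  have h2 := integral_card_sq_sub_le (V := V) p (r := 0) (by omega) ht ht1 hy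
  have h1 := integral_card_nearDomSets (V := V) p k 0
  rw [binomialCdf_zero, ← hμ] at h1 h2
  rw [real_eq_integral_ite]
  calc _ ≤ ∫ G, ((nearDomSets G k 0).card : ℝ) ∂G(V, p) -
        ∫ G, (((nearDomSets G k 0).card : ℝ) ^ 2 - (nearDomSets G k 0).card) ∂G(V, p) := by
        rw [h1]; linarith
    _ ≤ _ := by
        rw [← integral_sub Integrable.of_finite Integrable.of_finite]
        refine integral_mono Integrable.of_finite Integrable.of_finite fun G => ?_
        dsimp only
        by_cases hc : (nearDomSets G k 0).card = 1
        · rw [hc, if_pos]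
          · norm_num
          · obtain ⟨S, hS⟩ := Finset.card_eq_one.1 hc
            refine ⟨S, mem_domSets_iff.2 (by simp [hS]), fun T hT => ?_⟩
            have := mem_domSets_iff.1 hT
            simpa [hS] using this
        · have h3 : (0 : ℝ) ≤ if HasUniqueDomSet G k then (1 : ℝ) else 0 := by split_ifs <;> norm_num
          refine le_trans ?_ h3
          rcases Nat.lt_or_ge (nearDomSets G k 0).card 1 with h | h
          · rw [Nat.lt_one_iff.1 h]; norm_num
          · have h4 : (2 : ℝ) ≤ (nearDomSets G k 0).card := by
              exact_mod_cast (by omega : 2 ≤ (nearDomSets G k 0).card)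
            nlinarith

/-- Chebyshev: P(X = 0) ≤ Var(X)/μ². -/
lemma real_no_near_one_le (p : I) {k : ℕ} {t : ℝ} (ht : 0 < t) (ht1 : t ≤ 1)
    (hy : (1 - p : ℝ) ^ k < 1) {μ : ℝ} (hμ0 : 0 < μ)
    (hμ : μ = ((Fintype.card V).choose k : ℝ) *
      binomialCdf (Fintype.card V - k) ((1 - p : ℝ) ^ k) 1) :
    G(V, p).real {G | nearDomSets G k 1 = ∅} ≤
      (pairBound (Fintype.card V) k (1 - p) t + μ) / μ ^ 2 +
        (((1 - (1 - p : ℝ) ^ k) ^ (2 * k))⁻¹ - 1) := by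
  classical
  have h2 := integral_card_sq_sub_le (V := V) p (r := 1) (by omega) ht ht1 hy
  have h1 := integral_card_nearDomSets (V := V) p k 1
  rw [← hμ] at h1 h2
  rw [integral_sub Integrable.of_finite Integrable.of_finite, h1] at h2
  have h3 : G(V, p).real {G | nearDomSets G k 1 = ∅} * μ ^ 2 ≤
      ∫ G, (((nearDomSets G k 1).card : ℝ) - μ) ^ 2 ∂G(V, p) := by
    rw [real_eq_integral_ite, ← integral_mul_const]
    refine integral_mono Integrable.of_finite Integrable.of_finite fun G => ?_
    dsimp only
    split_ifs with h
    · rw [h]; simp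
    · rw [zero_mul]; positivity
  have h4 : ∫ G, (((nearDomSets G k 1).card : ℝ) - μ) ^ 2 ∂G(V, p) =
      ∫ G, ((nearDomSets G k 1).card : ℝ) ^ 2 ∂G(V, p) - μ ^ 2 := by
    have h5 : ∀ G : SimpleGraph V, (((nearDomSets G k 1).card : ℝ) - μ) ^ 2 =
        ((nearDomSets G k 1).card : ℝ) ^ 2 - (2 * μ) * (nearDomSets G k 1).card + μ ^ 2 :=
      fun G => by ring
    simp only [h5]
    rw [integral_add Integrable.of_finite Integrable.of_finite,
      integral_sub Integrable.of_finite Integrable.of_finite, integral_const_mul, h1]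
    simp
    ring
  rw [h4] at h3
  have h6 : (pairBound (Fintype.card V) k (1 - p) t + μ) / μ ^ 2 +
        (((1 - (1 - p : ℝ) ^ k) ^ (2 * k))⁻¹ - 1) =
      (pairBound (Fintype.card V) k (1 - p) t + μ + μ ^ 2 *
        ((1 - (1 - p : ℝ) ^ k) ^ (2 * k))⁻¹ - μ ^ 2) / μ ^ 2 := by
    field_simp
    ring
  rw [h6, le_div_iff₀ (by positivity)]
  linarith

/-- Every decision based on an induced subgraph is independent of the dominating sets that avoid
its vertices. -/
lemma le_real_decision_error (p : I) {k : ℕ} {t : ℝ} (ht : 0 < t) (ht1 : t ≤ 1) (U : Finset V)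
    (f : SimpleGraph (U : Set V) → Prop) {β : ℝ}
    (hβ : (U.card : ℝ) * ((Fintype.card V - 1).choose (k - 1) *
      nearBound (Fintype.card V) k (1 - p) t) ≤ β) {a : ℝ}
    (ha : a ≤ G(V, p).real {G | HasUniqueDomSet G k})
    (ha' : a ≤ 1 - G(V, p).real {G | HasDomSet G k}) :
    a - 2 * β ≤ G(V, p).real {G | ¬ (f (G.induce (U : Set V)) ↔ HasDomSet G k)} := by
  classical
  have hmeet := (real_near_meets_le p ht ht1 U (k := k)).trans hβ
  set bad : SimpleGraph V → Prop := fun G => ∃ T ∈ nearDomSets G k 2, ¬ Disjoint T U with hbad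
  set X' : SimpleGraph V → Prop := fun G => ∃ S : Finset V, S.card = k ∧ Disjoint S U ∧
    IsDominatingSet G S with hX'
  set g : SimpleGraph V → Prop := fun G => f (G.induce (U : Set V)) with hg
  have hXX : ∀ G, ¬ bad G → (X' G ↔ HasDomSet G k) := by
    intro G hG
    constructor
    · rintro ⟨S, h1, -, h3⟩
      exact ⟨S, h1, h3⟩
    · rintro ⟨S, hS⟩
      refine ⟨S, hS.1, ?_, hS.2⟩
      by_contra hd
      exact hG ⟨S, mem_nearDomSets_of_le (by omega) (mem_domSets_iff.1 hS), hd⟩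
  set F : Finset (Sym2 V) := Finset.univ.filter fun e => ∀ x ∈ e, x ∈ U with hF
  have hgdet : DeterminedBy (F : Set (Sym2 V)) g := by
    intro G G' hG
    have : G.induce (U : Set V) = G'.induce (U : Set V) := by
      ext ⟨x, hx⟩ ⟨y, hy⟩
      have := hG s(x, y) (by
        simp only [hF, Finset.coe_filter, Finset.mem_univ, true_and, Set.mem_ofPred_eq,
          Sym2.mem_iff, forall_eq_or_imp, forall_eq]
        exact ⟨hx, hy⟩)
      simpa using this
    simp only [hg, this]
  -- Domination by a set disjoint from U uses only potential edges with an end outside U, so `X'` is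
  -- independent of `g`.
  have hXdet : DeterminedBy ((Fᶜ : Finset (Sym2 V)) : Set (Sym2 V)) X' := by
    intro G G' hG
    refine propext (exists_congr fun S => and_congr_right fun _ => and_congr_right fun hSU => ?_)
    refine forall_congr' fun v => or_congr_right (exists_congr fun u => and_congr_right fun hu => ?_)
    have := hG s(u, v) (by
      simp only [hF, Finset.coe_compl, Finset.coe_filter, Finset.mem_univ, true_and,
        Set.mem_compl_iff, Set.mem_ofPred_eq, Sym2.mem_iff, forall_eq_or_imp, forall_eq]
      exact fun h => Finset.disjoint_left.1 hSU hu h.1)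
    simpa using this
  have h1 := real_and_of_determinedBy_disjoint p (disjoint_compl_right (a := F)) hgdet
    (hXdet.comp fun P => ¬ P)
  have h2 := real_and_of_determinedBy_disjoint p (disjoint_compl_right (a := F))
    (hgdet.comp fun P => ¬ P) hXdet
  rw [real_not] at h1 h2
  have h3 : G(V, p).real {G | ¬ (g G ↔ X' G)} = G(V, p).real {G | g G ∧ ¬ X' G} +
      G(V, p).real {G | ¬ g G ∧ X' G} := by
    rw [← measureReal_union _ MeasurableSet.of_discrete]
    · congr 1
      ext G
      simp only [Set.mem_ofPred_eq, Set.mem_union]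
      by_cases hG : g G <;> by_cases hG' : X' G <;> simp [hG, hG']
    · rw [Set.disjoint_left]
      intro G h h'
      exact h'.1 h.1
  have h4 : G(V, p).real {G | ¬ (g G ↔ X' G)} ≤
      G(V, p).real {G | ¬ (f (G.induce (U : Set V)) ↔ HasDomSet G k)} + β := by
    refine le_trans ?_ (add_le_add_right hmeet _)
    refine le_trans (real_mono fun G hG => ?_) (real_or_le p _ _)
    by_cases hb : bad G
    · exact Or.inr hb
    · left
      rwa [← hXX G hb]
  have h5 : G(V, p).real {G | HasUniqueDomSet G k} ≤ G(V, p).real {G | X' G} + β := by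
    refine le_trans ?_ (add_le_add_right hmeet _)
    refine le_trans (real_mono fun G hG => ?_) (real_or_le p _ _)
    by_cases hb : bad G
    · exact Or.inr hb
    · left
      exact (hXX G hb).2 hG.exists
  have h6 : G(V, p).real {G | X' G} ≤ G(V, p).real {G | HasDomSet G k} :=
    real_mono fun G ⟨S, h1, _, h3⟩ => ⟨S, h1, h3⟩
  have hβ0 : 0 ≤ β := le_trans measureReal_nonneg hmeet
  have hg0 : 0 ≤ G(V, p).real {G | g G} := measureReal_nonneg
  have hg1 : G(V, p).real {G | g G} ≤ 1 := measureReal_le_one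
  rw [h3, h1, h2] at h4
  -- By independence P(g and X' disagree) is a convex combination of P(X') and 1 - P(X'). These are
  -- at least a - β and a, and passing from X' back to `HasDomSet` costs another β.
  nlinarith

end RareEvents

/-! ### Locating q and ny from the expectation. -/

section Threshold

/-- The parameters are close to the threshold for a dominating set of size about `log n`. -/
structure NearThreshold (n k : ℕ) (q : ℝ) : Prop where
  le_log : 14 ≤ Real.log n
  lt_size : Real.log n - 1 < k
  size_lt : (k : ℝ) < Real.log n + 1
  log_size_le : Real.log (2 * k) ≤ Real.log n / 8
  log_pow_le : 32 * Real.log n ^ 10 ≤ n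
  le_q : 1 / 8 ≤ q
  q_le : q ≤ 1 / 2
  le_mul_pow : 3 / 4 * Real.log n ^ 2 ≤ n * q ^ k
  mul_pow_le : n * q ^ k ≤ 2 * Real.log n ^ 2
  choose_mul_exp_le : (n.choose k : ℝ) * Real.exp (-(n * q ^ k)) ≤ 2

/-- Taking logarithms, (n-k)y ≤ log C(n,k) - log a ≤ kL + L, which is about L²; the constant 2
absorbs the lower-order terms. -/
lemma mul_le_of_le_choose_mul {n k : ℕ} {L y a : ℝ} (hL : 14 ≤ L) (hexpL : Real.exp L = n)
    (hk2 : (k : ℝ) < L + 1) (hkn3 : 3 * (k : ℝ) ≤ n) (hy0 : 0 ≤ y) (hy1 : y ≤ 1) (ha : 0 < a)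
    (haL : -Real.log a ≤ L) (hμa : a ≤ (n.choose k : ℝ) * (1 - y) ^ (n - k)) :
    n * y ≤ 2 * L ^ 2 := by
  have hkn : k ≤ n := by
    have : (k : ℝ) ≤ n := by linarith [(Nat.cast_nonneg k : (0 : ℝ) ≤ k)]
    exact_mod_cast this
  have hC0 : (0 : ℝ) < n.choose k := by exact_mod_cast Nat.choose_pos hkn
  have hlogC : Real.log (n.choose k) ≤ k * L := by
    have hLn : L = Real.log n := by rw [← hexpL, Real.log_exp]
    rw [hLn, ← Real.log_pow]
    apply Real.log_le_log hC0
    exact_mod_cast Nat.choose_le_pow n k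
  have h1 : (1 - y) ^ (n - k) ≤ Real.exp (-((n - k) * y)) := by
    calc (1 - y) ^ (n - k) ≤ Real.exp (-y) ^ (n - k) := by
          have := Real.one_sub_le_exp_neg y
          have h0 : 0 ≤ 1 - y := by linarith
          gcongr
      _ = _ := by rw [← Real.exp_nat_mul, Nat.cast_sub hkn]; congr 1; ring
  have h2 : a ≤ n.choose k * Real.exp (-((n - k) * y)) := hμa.trans (by gcongr)
  have h3 := Real.log_le_log ha h2
  rw [Real.log_mul hC0.ne' (Real.exp_pos _).ne', Real.log_exp] at h3
  have h4 : (k : ℝ) * L ≤ (L + 1) * L := by gcongr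
  have h5 : (k : ℝ) * y ≤ n / 3 * y := by gcongr; linarith
  nlinarith

/-- From log(1-y) ≥ -y - 2y², replacing (1-y)^n by exp(-ny) costs at most exp(2ny²), and exp(-1/4) ≥
3/4. -/
lemma exp_neg_mul_le_pow {n k : ℕ} {y : ℝ} (hy0 : 0 ≤ y) (hyhalf : y ≤ 1 / 2)
    (hny2 : n * y ^ 2 ≤ 1 / 8) : Real.exp (-(n * y)) ≤ 4 / 3 * (1 - y) ^ (n - k) := by
  have hpos : 0 < 1 - y := by linarith
  have h1 : -y - 2 * y ^ 2 ≤ Real.log (1 - y) := by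
    refine le_trans ?_ (Real.one_sub_inv_le_log_of_pos hpos)
    have : 1 - (1 - y)⁻¹ = -y / (1 - y) := by field_simp; ring
    rw [this, le_div_iff₀ hpos]
    nlinarith [mul_nonneg (sq_nonneg y) (sub_nonneg.2 hyhalf)]
  have h2 : Real.exp (n * (-y - 2 * y ^ 2)) ≤ (1 - y) ^ n := by
    rw [← Real.exp_log (pow_pos hpos n), Real.log_pow]
    gcongr
  have h3 : (1 - y) ^ n ≤ (1 - y) ^ (n - k) :=
    pow_le_pow_of_le_one hpos.le (by linarith) (Nat.sub_le n k)
  have h4 : Real.exp (n * (-y - 2 * y ^ 2)) =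
      Real.exp (-(n * y)) * Real.exp (-(2 * (n * y ^ 2))) := by
    rw [← Real.exp_add]; congr 1; ring
  have h5 : 3 / 4 ≤ Real.exp (-(2 * (n * y ^ 2))) := by
    have := Real.add_one_le_exp (-(2 * (n * y ^ 2)))
    linarith
  rw [h4] at h2
  have h7 := mul_le_mul_of_nonneg_left h5 (Real.exp_pos (-(n * y))).le
  linarith

lemma div_pow_le_choose {n k : ℕ} (hk : 1 ≤ k) (hkn : 2 * k ≤ n) :
    ((n : ℝ) / (2 * k)) ^ k ≤ n.choose k := by
  refine le_trans ?_ (Nat.pow_le_choose (α := ℝ) k n)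
  have hk0 : (0 : ℝ) < k := by exact_mod_cast hk
  have hkn' : 2 * (k : ℝ) ≤ n := by exact_mod_cast hkn
  rw [le_div_iff₀ (by positivity)]
  have h2 : ((k.factorial : ℕ) : ℝ) ≤ (k : ℝ) ^ k := by exact_mod_cast Nat.factorial_le_pow k
  have h3 : (n : ℝ) / 2 ≤ ((n + 1 - k : ℕ) : ℝ) := by
    rw [Nat.cast_sub (by omega)]
    push_cast
    linarith
  calc ((n : ℝ) / (2 * k)) ^ k * k.factorial ≤ ((n : ℝ) / (2 * k)) ^ k * (k : ℝ) ^ k := by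
        gcongr
    _ = ((n : ℝ) / 2) ^ k := by
        rw [← mul_pow]; congr 1; field_simp
    _ ≤ _ := by gcongr

/-- The expectation is bounded, so ny is essentially at least log C(n,k) ≥ k log(n/2k) ≥
(L-1)(7/8)L. -/
lemma le_mul_of_choose_mul_exp_le {n k : ℕ} {L y : ℝ} (hL : 14 ≤ L) (hexpL : Real.exp L = n)
    (hk1 : L - 1 < k) (hkn : 2 * k ≤ n) (hlk : Real.log (2 * k) ≤ L / 8)
    (hC : (n.choose k : ℝ) * Real.exp (-(n * y)) ≤ 2) : 3 / 4 * L ^ 2 ≤ n * y := by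
  have hk0 : (0 : ℝ) < k := by linarith
  have hn0 : (0 : ℝ) < n := by rw [← hexpL]; exact Real.exp_pos L
  have hC0 : (0 : ℝ) < n.choose k := by exact_mod_cast Nat.choose_pos (by omega)
  have h2 := Real.log_le_log (by positivity) (div_pow_le_choose (by exact_mod_cast hk0) hkn)
  rw [Real.log_pow, Real.log_div hn0.ne' (by positivity), ← hexpL, Real.log_exp] at h2
  have h3 := Real.log_le_log (by positivity) hC
  rw [Real.log_mul hC0.ne' (Real.exp_pos _).ne', Real.log_exp] at h3
  have h4 : Real.log 2 ≤ 1 := by linarith [Real.log_two_lt_d9]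
  have h5 : (L - 1) * (L - L / 8) ≤ k * (L - Real.log (2 * k)) := by
    gcongr <;> linarith
  nlinarith

/-- If q < 1/8 then q^k < exp(-2k), since 3 log 2 > 2, and this beats n = exp(L) as k > L - 1. The
true value of q is near 1/e. -/
lemma eighth_le_of_one_le_mul_pow {n k : ℕ} {L q : ℝ} (hL : 14 ≤ L) (hexpL : Real.exp L = n)
    (hk1 : L - 1 < k) (hq0 : 0 ≤ q) (h : 1 < n * q ^ k) : 1 / 8 ≤ q := by
  by_contra! hq
  have h1 : q ^ k ≤ (1 / 8) ^ k := by gcongr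
  have h2 : n * q ^ k ≤ Real.exp (L - k * (3 * Real.log 2)) := by
    have h3 : ((1 : ℝ) / 8) ^ k = Real.exp (-(k * (3 * Real.log 2))) := by
      rw [← Real.exp_log (by positivity : (0 : ℝ) < (1 / 8) ^ k), Real.log_pow,
        show (1 : ℝ) / 8 = (2 ^ 3)⁻¹ by norm_num, Real.log_inv, Real.log_pow]
      congr 1
      push_cast
      ring
    rw [sub_eq_add_neg, Real.exp_add, hexpL, ← h3]
    gcongr
  have h4 : Real.exp (L - k * (3 * Real.log 2)) ≤ 1 := by
    rw [Real.exp_le_one_iff]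
    have := Real.log_two_gt_d9
    have h5 : (L - 1) * 2 ≤ k * (3 * Real.log 2) := by
      gcongr
      linarith
    linarith
  linarith

/-- If q > 1/2 then n·q^k ≥ exp(L - k log 2), a positive power of n because log 2 < 1, against a
polylogarithmic bound. -/
lemma le_half_of_mul_pow_le {n k : ℕ} {L q : ℝ} (hL : 14 ≤ L) (hexpL : Real.exp L = n)
    (hk2 : (k : ℝ) < L + 1) (hbig : 32 * L ^ 10 ≤ n) (h : n * q ^ k ≤ 2 * L ^ 2) :
    q ≤ 1 / 2 := by
  by_contra! hq
  have h1 : (1 / 2) ^ k ≤ q ^ k := by gcongr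
  have h2 : Real.exp (L - k * Real.log 2) ≤ n * q ^ k := by
    have h3 : ((1 : ℝ) / 2) ^ k = Real.exp (-(k * Real.log 2)) := by
      rw [← Real.exp_log (by positivity : (0 : ℝ) < (1 / 2) ^ k), Real.log_pow,
        one_div, Real.log_inv]
      congr 1
      ring
    rw [sub_eq_add_neg, Real.exp_add, hexpL, ← h3]
    gcongr
  have h4 := Real.log_le_log (Real.exp_pos _) (h2.trans h)
  rw [Real.log_exp, Real.log_mul (by norm_num) (by positivity), Real.log_pow] at h4
  have h5 := Real.log_le_log (by positivity) hbig
  rw [Real.log_mul (by norm_num) (by positivity), Real.log_pow,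
    show (32 : ℝ) = 2 ^ 5 by norm_num, Real.log_pow, ← hexpL, Real.log_exp] at h5
  push_cast at h4 h5
  have h6 := Real.log_two_lt_d9
  have h7 := Real.log_two_gt_d9
  have h8 : k * Real.log 2 ≤ (L + 1) * 0.6931471808 := by gcongr
  linarith

lemma nearThreshold_of_expectation {n k : ℕ} {q a : ℝ} (hL : 14 ≤ Real.log n)
    (hk : |(k : ℝ) - Real.log n| < 1) (hlk : Real.log (2 * k) ≤ Real.log n / 8)
    (hbig : 32 * Real.log n ^ 10 ≤ n) (hq0 : 0 ≤ q) (hq1 : q ≤ 1) (ha : 0 < a)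
    (haL : -Real.log a ≤ Real.log n)
    (hμa : a ≤ (n.choose k : ℝ) * (1 - q ^ k) ^ (n - k))
    (hμ1 : (n.choose k : ℝ) * (1 - q ^ k) ^ (n - k) ≤ 1) : NearThreshold n k q := by
  set L := Real.log n with hLdef
  rw [abs_lt] at hk
  have hk1 : L - 1 < k := by linarith [hk.1]
  have hk2 : (k : ℝ) < L + 1 := by linarith [hk.2]
  have hL1 : 1 ≤ L := by linarith
  have hL10 : L ≤ L ^ 10 := by
    simpa using pow_le_pow_right₀ hL1 (show 1 ≤ 10 by norm_num)
  have hn0 : (0 : ℝ) < n := by linarith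
  have hexpL : Real.exp L = n := Real.exp_log hn0
  have hkn3 : 3 * (k : ℝ) ≤ n := by linarith
  have hkn : 2 * k ≤ n := by
    have : 2 * (k : ℝ) ≤ n := by linarith
    exact_mod_cast this
  have hy0 : 0 ≤ q ^ k := pow_nonneg hq0 _
  have hy1 : q ^ k ≤ 1 := pow_le_one₀ hq0 hq1
  have hupper := mul_le_of_le_choose_mul hL hexpL hk2 hkn3 hy0 hy1 ha haL hμa
  have hyL : q ^ k * L ^ 8 ≤ 1 / 16 := by
    have h1 : 32 * L ^ 10 * q ^ k ≤ 2 * L ^ 2 := le_trans (by gcongr) hupper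
    have h2 : 32 * L ^ 10 * q ^ k = (2 * L ^ 2) * (16 * (q ^ k * L ^ 8)) := by ring
    rw [h2] at h1
    have h3 : 0 < 2 * L ^ 2 := by positivity
    have h4 := le_of_mul_le_mul_left (h1.trans_eq (mul_one _).symm) h3
    linarith
  have hyhalf : q ^ k ≤ 1 / 2 := by
    have h1 : (1 : ℝ) ≤ L ^ 8 := one_le_pow₀ hL1
    have h2 := mul_le_mul_of_nonneg_left h1 hy0
    linarith
  have hny2 : n * (q ^ k) ^ 2 ≤ 1 / 8 := by
    have h1 : n * (q ^ k) ^ 2 ≤ 2 * L ^ 2 * q ^ k := by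
      rw [sq (q ^ k), ← mul_assoc]
      gcongr
    have h2 : L ^ 2 * q ^ k ≤ L ^ 8 * q ^ k := by
      have : L ^ 2 ≤ L ^ 8 := pow_le_pow_right₀ hL1 (by norm_num)
      gcongr
    linarith
  have hCexp : (n.choose k : ℝ) * Real.exp (-(n * q ^ k)) ≤ 2 := by
    calc (n.choose k : ℝ) * Real.exp (-(n * q ^ k))
        ≤ n.choose k * (4 / 3 * (1 - q ^ k) ^ (n - k)) := by
          gcongr
          exact exp_neg_mul_le_pow hy0 hyhalf hny2
      _ = 4 / 3 * (n.choose k * (1 - q ^ k) ^ (n - k)) := by ring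
      _ ≤ 2 := by linarith
  have hlower := le_mul_of_choose_mul_exp_le hL hexpL hk1 hkn hlk hCexp
  refine ⟨hL, hk1, hk2, hlk, hbig, ?_, ?_, hlower, hupper, hCexp⟩
  · refine eighth_le_of_one_le_mul_pow hL hexpL hk1 hq0 (lt_of_lt_of_le ?_ hlower)
    have : L ≤ L ^ 2 := by simpa using pow_le_pow_right₀ hL1 (show 1 ≤ 2 by norm_num)
    linarith
  · exact le_half_of_mul_pow_le hL hexpL hk2 hbig hupper

lemma tendsto_log_natCast : Tendsto (fun n : ℕ => Real.log n) atTop atTop :=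
  Real.tendsto_log_atTop.comp tendsto_natCast_atTop_atTop

lemma eventually_nearThreshold {δ : ℝ} (hδ0 : 0 < δ) (hδ1 : δ < 1) {k : ℕ → ℕ}
    (hk : ∀ n : ℕ, 1 ≤ n → |(k n : ℝ) - Real.log n| < 1) {p : ℕ → I}
    (hμ : Tendsto (fun n => expectedDomSets n (k n) (p n)) atTop (𝓝 δ)) :
    ∀ᶠ n : ℕ in atTop, NearThreshold n (k n) (1 - p n) := by
  have hloglog : ∀ᶠ n : ℕ in atTop, Real.log (2 * (Real.log n + 1)) ≤ Real.log n / 8 := by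
    have h1 : Tendsto (fun n : ℕ => 2 * (Real.log n + 1)) atTop atTop :=
      (tendsto_atTop_add_const_right _ _ tendsto_log_natCast).const_mul_atTop (by norm_num)
    have h2 := (Real.isLittleO_log_id_atTop.comp_tendsto h1).bound (show (0 : ℝ) < 1 / 32 by norm_num)
    filter_upwards [h2, tendsto_log_natCast.eventually_ge_atTop 14] with n h3 h4
    simp only [Function.comp_apply, id_eq, Real.norm_eq_abs] at h3
    rw [abs_of_nonneg (by linarith : (0 : ℝ) ≤ 2 * (Real.log n + 1))] at h3
    have := le_abs_self (Real.log (2 * (Real.log n + 1)))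
    linarith
  have hpow : ∀ᶠ n : ℕ in atTop, 32 * Real.log n ^ 10 ≤ n := by
    have h1 := ((Real.isLittleO_pow_log_id_atTop (n := 10)).comp_tendsto
      (tendsto_natCast_atTop_atTop (R := ℝ))).bound (show (0 : ℝ) < 1 / 32 by norm_num)
    filter_upwards [h1] with n h2
    simp only [Function.comp_apply, id_eq, Real.norm_eq_abs, Nat.abs_cast] at h2
    have := le_abs_self (Real.log n ^ 10)
    linarith
  filter_upwards [hloglog, hpow, tendsto_log_natCast.eventually_ge_atTop 14,
    tendsto_log_natCast.eventually_ge_atTop (-Real.log (δ / 2)), eventually_ge_atTop 1,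
    hμ.eventually_const_le (show δ / 2 < δ by linarith), hμ.eventually_le_const hδ1]
    with n h1 h2 h3 h4 h5 h6 h7
  have hkn := hk n h5
  rw [expectedDomSets_eq] at h6 h7
  have hk' := abs_lt.1 hkn
  have hk0 : (0 : ℝ) < k n := by linarith [hk'.1]
  refine nearThreshold_of_expectation h3 hkn (le_trans ?_ h1) h2 (sub_nonneg.2 (p n).2.2)
    (by linarith [(p n).2.1]) (by linarith : 0 < δ / 2) h4 h6 h7
  apply Real.log_le_log (by positivity)
  linarith [hk'.2]

end Threshold

/-! ### Numerical bounds for the single-set quantities at the threshold. -/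

section ThresholdEstimates

lemma one_sub_pow_le_exp {x : ℝ} (hx : x ≤ 1) (m : ℕ) : (1 - x) ^ m ≤ Real.exp (-(m * x)) := by
  calc (1 - x) ^ m ≤ Real.exp (-x) ^ m := by
        have h1 := Real.one_sub_le_exp_neg x
        have h0 : 0 ≤ 1 - x := by linarith
        gcongr
    _ = _ := by rw [← Real.exp_nat_mul]; congr 1; ring

lemma exp_three_le : Real.exp 3 ≤ 21 := by
  have h := Real.exp_one_lt_d9
  have h1 : Real.exp 3 = Real.exp 1 ^ 3 := by rw [← Real.exp_nat_mul]; norm_num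
  rw [h1]
  calc Real.exp 1 ^ 3 ≤ (2.7182818286 : ℝ) ^ 3 := by gcongr
    _ ≤ 21 := by norm_num

/-- Each step down in the lower index multiplies the binomial coefficient by at most k/(n-k). -/
lemma choose_sub_mul_pow_le {n k i : ℕ} (hik : i ≤ k) :
    n.choose (k - i) * (n - k) ^ i ≤ n.choose k * k ^ i := by
  induction i with
  | zero => simp
  | succ i ih =>
    have h1 := ih (by omega)
    have h2 := Nat.choose_succ_right_eq n (k - (i + 1))
    rw [show k - (i + 1) + 1 = k - i by omega] at h2
    calc n.choose (k - (i + 1)) * (n - k) ^ (i + 1)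
        = n.choose (k - (i + 1)) * (n - k) * (n - k) ^ i := by ring
      _ ≤ n.choose (k - (i + 1)) * (n - (k - (i + 1))) * (n - k) ^ i := by
          gcongr; omega
      _ = (n.choose (k - i) * (n - k) ^ i) * (k - i) := by rw [← h2]; ring
      _ ≤ (n.choose k * k ^ i) * k := by gcongr; omega
      _ = _ := by ring

namespace NearThreshold

variable {n k : ℕ} {q : ℝ}

lemma size_pos (h : NearThreshold n k q) : (0 : ℝ) < n := by
  have := h.le_log
  refine lt_of_lt_of_le ?_ h.log_pow_le
  positivity

lemma exp_log_eq (h : NearThreshold n k q) : Real.exp (Real.log n) = n := Real.exp_log h.size_pos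

lemma size_le (h : NearThreshold n k q) : (k : ℝ) ≤ 2 * Real.log n := by
  linarith [h.size_lt, h.le_log]

lemma le_size (h : NearThreshold n k q) : 13 ≤ k := by
  have : (13 : ℝ) ≤ k := by linarith [h.lt_size, h.le_log]
  exact_mod_cast this

lemma pow_pow_le (h : NearThreshold n k q) {j : ℕ} (hj : j ≤ 10) : 32 * Real.log n ^ j ≤ n := by
  refine le_trans ?_ h.log_pow_le
  have : Real.log n ^ j ≤ Real.log n ^ 10 := pow_le_pow_right₀ (by linarith [h.le_log]) hj
  linarith

lemma ten_mul_size_le (h : NearThreshold n k q) : 10 * k ≤ n := by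
  have h1 := h.pow_pow_le (j := 1) (by norm_num)
  have h2 := h.size_le
  have h3 := h.le_log
  have : 10 * (k : ℝ) ≤ n := by linarith
  exact_mod_cast this

lemma pow_nonneg (h : NearThreshold n k q) (j : ℕ) : 0 ≤ q ^ j :=
  _root_.pow_nonneg (by linarith [h.le_q]) j

lemma pow_le (h : NearThreshold n k q) : q ^ k ≤ 2 * Real.log n ^ 2 / n := by
  rw [le_div_iff₀ h.size_pos, mul_comm]
  exact h.mul_pow_le

lemma eight_mul_size_mul_pow_le (h : NearThreshold n k q) : 8 * (k * q ^ k) ≤ 1 := by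
  have h1 := h.pow_pow_le (j := 3) (by norm_num)
  have h2 : (k : ℝ) * q ^ k ≤ 2 * Real.log n * (2 * Real.log n ^ 2 / n) := by
    have := h.le_log
    have := h.pow_nonneg k
    gcongr
    · exact h.size_le
    · exact h.pow_le
  have h3 : 2 * Real.log n * (2 * Real.log n ^ 2 / n) = 4 * Real.log n ^ 3 / n := by ring
  rw [h3, le_div_iff₀ h.size_pos] at h2
  have h4 := h.size_pos
  by_contra! hcon
  nlinarith

lemma pow_le_half (h : NearThreshold n k q) : q ^ k ≤ 1 / 2 := by
  have h1 := h.eight_mul_size_mul_pow_le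
  have h2 : (13 : ℝ) ≤ k := by exact_mod_cast h.le_size
  have h3 := h.pow_nonneg k
  nlinarith

/-- The tilt t = 1/L² makes t·ny ≤ 2, so the exponential changes by at most e³ and the product with
C(n,k) stays bounded; the price is only t^(-2) = L⁴. -/
lemma choose_mul_nearBound_le (h : NearThreshold n k q) :
    (n.choose k : ℝ) * nearBound n k q (Real.log n ^ 2)⁻¹ ≤ 84 * Real.log n ^ 4 := by
  have hL := h.le_log
  set L := Real.log n with hLdef
  have hkn : k ≤ n := by have := h.ten_mul_size_le; omega
  have hy0 := h.pow_nonneg k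
  have hy1 := h.pow_le_half
  have hky := h.eight_mul_size_mul_pow_le
  have hny := h.mul_pow_le
  have hC := h.choose_mul_exp_le
  have ht0 : 0 < (L ^ 2)⁻¹ := by positivity
  have htny : (L ^ 2)⁻¹ * (n * q ^ k) ≤ 2 := by
    rw [inv_mul_le_iff₀ (by positivity)]
    linarith
  have h1 : (1 - (1 - (L ^ 2)⁻¹) * q ^ k) ^ (n - k) ≤ Real.exp (-(n * q ^ k)) * Real.exp 3 := by
    refine (one_sub_pow_le_exp (by nlinarith) _).trans ?_
    rw [← Real.exp_add]
    gcongr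
    rw [Nat.cast_sub hkn]
    have h3 : 0 ≤ (L ^ 2)⁻¹ * (k * q ^ k) := by positivity
    have h4 : ((n : ℝ) - k) * ((1 - (L ^ 2)⁻¹) * q ^ k) = n * q ^ k - k * q ^ k -
      (L ^ 2)⁻¹ * (n * q ^ k) + (L ^ 2)⁻¹ * (k * q ^ k) := by ring
    rw [h4]
    linarith
  have h2 : (((L ^ 2)⁻¹) ^ 2)⁻¹ = L ^ 4 := by
    rw [inv_pow, inv_inv]; ring
  unfold nearBound
  rw [h2]
  calc (n.choose k : ℝ) * (L ^ 4 * (1 - (1 - (L ^ 2)⁻¹) * q ^ k) ^ (n - k))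
      ≤ (n.choose k : ℝ) * (L ^ 4 * (Real.exp (-(n * q ^ k)) * Real.exp 3)) := by gcongr
    _ = (n.choose k * Real.exp (-(n * q ^ k))) * Real.exp 3 * L ^ 4 := by ring
    _ ≤ 2 * 21 * L ^ 4 := by
        gcongr
        exact exp_three_le
    _ ≤ 84 * L ^ 4 := by
        have : 0 ≤ L ^ 4 := by positivity
        linarith

lemma choose_pred_mul_nearBound_le (h : NearThreshold n k q) :
    ((n - 1).choose (k - 1) : ℝ) * nearBound n k q (Real.log n ^ 2)⁻¹ ≤
      168 * Real.log n ^ 5 / n := by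
  have hn := h.size_pos
  have hL := h.le_log
  have hk := h.le_size
  have hkn := h.ten_mul_size_le
  have h1 : (n : ℝ) * (n - 1).choose (k - 1) = k * n.choose k := by
    have := Nat.add_one_mul_choose_eq (n - 1) (k - 1)
    rw [show n - 1 + 1 = n by omega, show k - 1 + 1 = k by omega] at this
    rw [mul_comm (k : ℝ)]
    exact_mod_cast this
  rw [le_div_iff₀ hn]
  have h2 := h.choose_mul_nearBound_le
  calc ((n - 1).choose (k - 1) : ℝ) * nearBound n k q (Real.log n ^ 2)⁻¹ * n
      = (n * (n - 1).choose (k - 1)) * nearBound n k q (Real.log n ^ 2)⁻¹ := by ring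
    _ = k * (n.choose k * nearBound n k q (Real.log n ^ 2)⁻¹) := by rw [h1]; ring
    _ ≤ (2 * Real.log n) * (84 * Real.log n ^ 4) := by
        refine mul_le_mul h.size_le h2 ?_ (by linarith)
        have : 0 ≤ nearBound n k q (Real.log n ^ 2)⁻¹ := by
          have h3 := h.pow_le_half
          have h4 := h.pow_nonneg k
          have h5 : 0 < (Real.log n ^ 2)⁻¹ := by positivity
          have : 0 ≤ 1 - (1 - (Real.log n ^ 2)⁻¹) * q ^ k := by nlinarith
          unfold nearBound
          positivity
        positivity
    _ = _ := by ring

lemma choose_mul_singleton_le (h : NearThreshold n k q) :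
    (n.choose k : ℝ) * (q ^ k * (1 - q ^ k) ^ (n - k - 1)) ≤ 84 * Real.log n ^ 2 / n := by
  have hn := h.size_pos
  have hy0 := h.pow_nonneg k
  have hy1 := h.pow_le_half
  have hky := h.eight_mul_size_mul_pow_le
  have hkn := h.ten_mul_size_le
  have hC := h.choose_mul_exp_le
  have hk := h.le_size
  have h1 : (1 - q ^ k) ^ (n - k - 1) ≤ Real.exp (-(n * q ^ k)) * Real.exp 3 := by
    refine (one_sub_pow_le_exp (by linarith) _).trans ?_
    rw [← Real.exp_add]
    gcongr
    rw [Nat.sub_sub, Nat.cast_sub (by omega)]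
    push_cast
    nlinarith
  calc (n.choose k : ℝ) * (q ^ k * (1 - q ^ k) ^ (n - k - 1))
      ≤ (n.choose k : ℝ) * (q ^ k * (Real.exp (-(n * q ^ k)) * Real.exp 3)) := by gcongr
    _ = (n.choose k * Real.exp (-(n * q ^ k))) * Real.exp 3 * q ^ k := by ring
    _ ≤ 2 * 21 * (2 * Real.log n ^ 2 / n) := by
        gcongr
        · exact exp_three_le
        · exact h.pow_le
    _ = _ := by ring

/-- Since q ≤ 1/2, q^(k-1) ≥ 2q^k, so the failure probability for one set is about exp(-2ny) at
most. One factor exp(-ny) pays for C(n,k), the other is at most 1/n. -/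
lemma choose_mul_no_private_le (h : NearThreshold n k q) {u : ℕ}
    (hu : 2 * Real.log n ^ 2 * u ≤ n) :
    (n.choose k : ℝ) * (k * (1 - q ^ (k - 1)) ^ (n - k - u)) ≤ 84 * Real.log n / n := by
  have hn := h.size_pos
  have hL := h.le_log
  have hy0 := h.pow_nonneg k
  have hky := h.eight_mul_size_mul_pow_le
  have hC := h.choose_mul_exp_le
  have hk := h.le_size
  have hqk : q * q ^ (k - 1) = q ^ k := by rw [← pow_succ', show k - 1 + 1 = k by omega]
  have h0 := h.pow_nonneg (k - 1)
  have hx : 2 * q ^ k ≤ q ^ (k - 1) := by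
    have := h.q_le
    nlinarith
  have hx1 : q ^ (k - 1) ≤ 1 := pow_le_one₀ (by linarith [h.le_q]) (by linarith [h.q_le])
  have huy : u * q ^ k ≤ 1 := by
    calc u * q ^ k ≤ u * (2 * Real.log n ^ 2 / n) := by
          gcongr
          exact h.pow_le
      _ ≤ 1 := by
          rw [← mul_div_assoc, div_le_one hn]
          linarith
  have h1 : (1 - q ^ (k - 1)) ^ (n - k - u) ≤
      Real.exp (-(n * q ^ k)) * Real.exp (-(n * q ^ k)) * Real.exp 3 := by
    refine (one_sub_pow_le_exp hx1 _).trans ?_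
    rw [← Real.exp_add, ← Real.exp_add]
    gcongr
    have h2 : (n : ℝ) - k - u ≤ ((n - k - u : ℕ) : ℝ) := by
      have : (n : ℝ) ≤ ((n - k - u : ℕ) : ℝ) + k + u := by
        exact_mod_cast (by omega : n ≤ (n - k - u) + k + u)
      linarith
    have h3 : ((n : ℝ) - k - u) * (2 * q ^ k) ≤ ((n - k - u : ℕ) : ℝ) * q ^ (k - 1) := by
      calc ((n : ℝ) - k - u) * (2 * q ^ k) ≤ ((n - k - u : ℕ) : ℝ) * (2 * q ^ k) := by gcongr
        _ ≤ _ := by gcongr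
    linarith
  have h2 : Real.exp (-(n * q ^ k)) ≤ 1 / n := by
    rw [← h.exp_log_eq, one_div, ← Real.exp_neg, Real.exp_log hn]
    gcongr
    have := h.le_mul_pow
    nlinarith
  calc (n.choose k : ℝ) * (k * (1 - q ^ (k - 1)) ^ (n - k - u))
      ≤ (n.choose k : ℝ) * (k * (Real.exp (-(n * q ^ k)) * Real.exp (-(n * q ^ k)) *
          Real.exp 3)) := by gcongr
    _ = (n.choose k * Real.exp (-(n * q ^ k))) * Real.exp 3 * k * Real.exp (-(n * q ^ k)) := by ring
    _ ≤ 2 * 21 * (2 * Real.log n) * (1 / n) := by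
        gcongr
        · exact exp_three_le
        · exact h.size_le
    _ = _ := by ring

lemma inv_one_sub_pow_le (h : NearThreshold n k q) :
    ((1 - q ^ k) ^ (2 * k))⁻¹ ≤ 1 + 16 * Real.log n ^ 3 / n := by
  have hn := h.size_pos
  have hL := h.le_log
  have hy0 := h.pow_nonneg k
  have hy1 := h.pow_le_half
  have hky := h.eight_mul_size_mul_pow_le
  have h1 : 1 - 2 * (k * q ^ k) ≤ (1 - q ^ k) ^ (2 * k) := by
    have := one_add_mul_le_pow (show (-2 : ℝ) ≤ -(q ^ k) by linarith) (2 * k)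
    push_cast at this
    calc 1 - 2 * (k * q ^ k) = 1 + 2 * k * -(q ^ k) := by ring
      _ ≤ (1 + -(q ^ k)) ^ (2 * k) := this
      _ = _ := by rw [← sub_eq_add_neg]
  have h2 : (k : ℝ) * q ^ k ≤ 4 * Real.log n ^ 3 / n := by
    calc (k : ℝ) * q ^ k ≤ 2 * Real.log n * (2 * Real.log n ^ 2 / n) := by
          gcongr
          · exact h.size_le
          · exact h.pow_le
      _ = _ := by ring
  have h3 : 16 * Real.log n ^ 3 / n = 4 * (4 * Real.log n ^ 3 / n) := by ring
  have hky0 : 0 ≤ k * q ^ k := by positivity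
  have h4 : ((1 - q ^ k) ^ (2 * k))⁻¹ ≤ (1 - 2 * (k * q ^ k))⁻¹ := by
    gcongr
    linarith
  refine h4.trans ?_
  rw [inv_le_iff_one_le_mul₀ (by linarith), h3]
  nlinarith

/-- The term for exactly one missed vertex is at least (n-k)y times the term for none, and ny has
order L². -/
lemma le_choose_mul_binomialCdf (h : NearThreshold n k q) :
    ((n.choose k : ℝ) * (1 - q ^ k) ^ (n - k)) * (Real.log n ^ 2 / 4) ≤
      (n.choose k : ℝ) * binomialCdf (n - k) (q ^ k) 1 := by
  have hn := h.size_pos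
  have hy0 := h.pow_nonneg k
  have hy1 := h.pow_le_half
  have hkn := h.ten_mul_size_le
  have hkn' : 10 * (k : ℝ) ≤ n := by exact_mod_cast hkn
  rw [binomialCdf_one, mul_assoc]
  gcongr ?_ * ?_
  have h0 : 0 ≤ 1 - q ^ k := by linarith
  have h1 : (1 - q ^ k) ^ (n - k) ≤ (1 - q ^ k) ^ (n - k - 1) :=
    pow_le_pow_of_le_one h0 (by linarith) (by omega)
  have h2 : Real.log n ^ 2 / 4 ≤ ((n - k : ℕ) : ℝ) * q ^ k := by
    rw [Nat.cast_sub (by omega)]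
    have h3 := h.le_mul_pow
    have h4 : (k : ℝ) * q ^ k ≤ n / 10 * q ^ k := by gcongr; linarith
    nlinarith [sq_nonneg (Real.log n)]
  calc (1 - q ^ k) ^ (n - k) * (Real.log n ^ 2 / 4)
      ≤ (1 - q ^ k) ^ (n - k - 1) * (((n - k : ℕ) : ℝ) * q ^ k) := by gcongr
    _ = ((n - k : ℕ) : ℝ) * (q ^ k * (1 - q ^ k) ^ (n - k - 1)) := by ring
    _ ≤ _ := by
        have : 0 ≤ (1 - q ^ k) ^ (n - k) := by positivity
        linarith

end NearThreshold

end ThresholdEstimates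

/-! ### Intersecting pairs, split by the size i of the overlap. -/

section PairEstimate

namespace NearThreshold

variable {n k : ℕ} {q : ℝ}

/-- For i ≤ 3k/4 one has (q^(k-i))⁴ ≤ q^k, so the fourth power of the left side is at most
(2L²)⁴·2L²/n = 32L¹⁰/n. This is the source of `log_pow_le`. -/
lemma pow_sub_mul_le_one (h : NearThreshold n k q) {i : ℕ} (hi : 4 * i ≤ 3 * k) :
    n * q ^ k * q ^ (k - i) ≤ 1 := by
  have hn := h.size_pos
  have hL := h.le_log
  have hq0 : 0 ≤ q := by linarith [h.le_q]
  have hq1 : q ≤ 1 := by linarith [h.q_le]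
  have h0 := h.pow_nonneg k
  have h0' := h.pow_nonneg (k - i)
  have h1 : (q ^ (k - i)) ^ 4 ≤ q ^ k := by
    rw [← pow_mul]
    exact pow_le_pow_of_le_one hq0 hq1 (by omega)
  have h2 : (n * q ^ k * q ^ (k - i)) ^ 4 ≤ 1 := by
    calc (n * q ^ k * q ^ (k - i)) ^ 4 = (n * q ^ k) ^ 4 * (q ^ (k - i)) ^ 4 := by ring
      _ ≤ (2 * Real.log n ^ 2) ^ 4 * (2 * Real.log n ^ 2 / n) := by
          exact mul_le_mul (pow_le_pow_left₀ (by positivity) h.mul_pow_le 4) (h1.trans h.pow_le)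
            (by positivity) (by positivity)
      _ = 32 * Real.log n ^ 10 / n := by ring
      _ ≤ 1 := by
          rw [div_le_one hn]
          exact h.log_pow_le
  exact (pow_le_one_iff_of_nonneg (by positivity) (by norm_num)).1 h2

/-- The correlation factor is bounded by `pow_sub_mul_le_one`, and fixing i common vertices saves
(k²/(n-k))^i, already enough for i = 1. -/
lemma choose_mul_choose_le_of_small (h : NearThreshold n k q) {i : ℕ} (hi1 : 1 ≤ i)
    (hi : 4 * i ≤ 3 * k) :
    ((k.choose i * n.choose (k - i) : ℕ) : ℝ) *
      Real.exp (-(n * q ^ k) + n * q ^ k * q ^ (k - i)) ≤ 168 * Real.log n ^ 2 / n := by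
  have hn := h.size_pos
  have hL := h.le_log
  have hkn := h.ten_mul_size_le
  have hkn' : 10 * (k : ℝ) ≤ n := by exact_mod_cast hkn
  have hk := h.size_le
  have hik : i ≤ k := by omega
  have hnk : (n : ℝ) / 2 ≤ n - k := by linarith [(Nat.cast_nonneg k : (0 : ℝ) ≤ k)]
  have hnk0 : (0 : ℝ) < n - k := by linarith
  have hr0 : (0 : ℝ) ≤ k ^ 2 / (n - k) := by positivity
  have hr : (k : ℝ) ^ 2 / (n - k) ≤ 8 * Real.log n ^ 2 / n := by
    calc (k : ℝ) ^ 2 / (n - k) ≤ (2 * Real.log n) ^ 2 / (n / 2) := by gcongr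
      _ = _ := by field_simp; ring
  have hr1 : (k : ℝ) ^ 2 / (n - k) ≤ 1 := by
    refine hr.trans ?_
    rw [div_le_one hn]
    have := h.pow_pow_le (j := 2) (by norm_num)
    nlinarith
  have h1 : ((k.choose i * n.choose (k - i) : ℕ) : ℝ) ≤ n.choose k * (k ^ 2 / (n - k)) := by
    have h2 : (n.choose (k - i) : ℝ) * (n - k) ^ i ≤ n.choose k * k ^ i := by
      have := choose_sub_mul_pow_le (n := n) hik
      rw [← Nat.cast_sub (by omega)]
      exact_mod_cast this
    have h3 : (n.choose (k - i) : ℝ) ≤ n.choose k * k ^ i / (n - k) ^ i := by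
      rwa [le_div_iff₀ (by positivity)]
    have h4 : (k.choose i : ℝ) ≤ k ^ i := by exact_mod_cast Nat.choose_le_pow k i
    push_cast
    calc (k.choose i : ℝ) * n.choose (k - i) ≤ k ^ i * (n.choose k * k ^ i / (n - k) ^ i) := by
          gcongr
      _ = n.choose k * (k ^ 2 / (n - k)) ^ i := by rw [div_pow]; ring
      _ ≤ n.choose k * (k ^ 2 / (n - k)) := by
          gcongr
          exact pow_le_of_le_one hr0 hr1 (by omega)
  have h5 : Real.exp (n * q ^ k * q ^ (k - i)) ≤ 21 / 2 := by
    have h6 : Real.exp (n * q ^ k * q ^ (k - i)) ≤ Real.exp 1 := by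
      gcongr
      exact h.pow_sub_mul_le_one hi
    linarith [Real.exp_one_lt_d9]
  have hC := h.choose_mul_exp_le
  rw [Real.exp_add]
  calc ((k.choose i * n.choose (k - i) : ℕ) : ℝ) *
        (Real.exp (-(n * q ^ k)) * Real.exp (n * q ^ k * q ^ (k - i)))
      ≤ (n.choose k * (k ^ 2 / (n - k))) *
        (Real.exp (-(n * q ^ k)) * Real.exp (n * q ^ k * q ^ (k - i))) := by gcongr
    _ = (n.choose k * Real.exp (-(n * q ^ k))) * Real.exp (n * q ^ k * q ^ (k - i)) *
        (k ^ 2 / (n - k)) := by ring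
    _ ≤ 2 * (21 / 2) * (8 * Real.log n ^ 2 / n) := by gcongr
    _ = _ := by ring

/-- For large overlap the correlation is strong but there are few sets T': fewer than k/4 vertices
of each are free, while the conditional cost is still exp(-ny/2), as q^(k-i) ≤ 1/2. -/
lemma choose_mul_choose_le_of_large (h : NearThreshold n k q) {i : ℕ} (hik : i < k)
    (hi : 3 * k < 4 * i) :
    ((k.choose i * n.choose (k - i) : ℕ) : ℝ) *
      Real.exp (-(n * q ^ k) + n * q ^ k * q ^ (k - i)) ≤ 1 / n := by
  have hn := h.size_pos
  have hL := h.le_log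
  have hk13 : (13 : ℝ) ≤ k := by exact_mod_cast h.le_size
  have hq0 : 0 ≤ q := by linarith [h.le_q]
  have hq1 : q ≤ 1 := by linarith [h.q_le]
  have hj : q ^ (k - i) ≤ 1 / 2 :=
    (pow_le_of_le_one hq0 hq1 (by omega : k - i ≠ 0)).trans h.q_le
  have hlogk : Real.log k ≤ Real.log n / 8 := by
    refine le_trans ?_ h.log_size_le
    exact Real.log_le_log (by linarith) (by linarith)
  have h1 : ((k.choose i * n.choose (k - i) : ℕ) : ℝ) ≤
      Real.exp ((k - i : ℕ) * (Real.log k + Real.log n)) := by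
    have h2 : k.choose i * n.choose (k - i) ≤ k ^ (k - i) * n ^ (k - i) := by
      rw [← Nat.choose_symm hik.le]
      exact Nat.mul_le_mul (Nat.choose_le_pow _ _) (Nat.choose_le_pow _ _)
    rw [Real.exp_nat_mul, Real.exp_add, Real.exp_log (by linarith), Real.exp_log hn, mul_pow]
    exact_mod_cast h2
  have h3 : ((k - i : ℕ) : ℝ) ≤ k / 4 := by
    rw [Nat.cast_sub hik.le]
    have : 3 * (k : ℝ) ≤ 4 * i := by exact_mod_cast hi.le
    linarith
  have h4 : ((k - i : ℕ) : ℝ) * (Real.log k + Real.log n) ≤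
      (Real.log n + 1) / 4 * (9 / 8 * Real.log n) := by
    have h5 : 0 ≤ Real.log k := Real.log_nonneg (by linarith)
    gcongr
    · linarith [h.size_lt]
    · linarith
  have h6 : n * q ^ k * q ^ (k - i) ≤ n * q ^ k * (1 / 2) := by
    have := h.pow_nonneg k
    gcongr
  have h7 := h.le_mul_pow
  calc ((k.choose i * n.choose (k - i) : ℕ) : ℝ) *
        Real.exp (-(n * q ^ k) + n * q ^ k * q ^ (k - i))
      ≤ Real.exp ((k - i : ℕ) * (Real.log k + Real.log n)) *
        Real.exp (-(n * q ^ k) + n * q ^ k * q ^ (k - i)) := by gcongr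
    _ ≤ Real.exp (-Real.log n) := by
        rw [← Real.exp_add]
        gcongr
        -- With ny ≥ (3/4)L² this is (9/32)L(L+1) + L ≤ (3/8)L², that is 3L ≥ 41, covered by L ≥ 14.
        nlinarith
    _ = 1 / n := by rw [Real.exp_neg, Real.exp_log hn, one_div]

/-- Splits the joint probability into the cost exp(-ny) of T and a conditional cost for T'; the tilt
and the 2k excluded vertices account for the bounded factor. -/
lemma pair_factor_le (h : NearThreshold n k q) {i : ℕ} (hik : i < k) :
    (1 - (1 - (Real.log n ^ 2)⁻¹) * (2 * q ^ k - q ^ (2 * k - i))) ^ (n - 2 * k) ≤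
      Real.exp (-(n * q ^ k)) * Real.exp (-(n * q ^ k) + n * q ^ k * q ^ (k - i)) *
        Real.exp 3 ^ 2 := by
  have hn := h.size_pos
  have hL := h.le_log
  have hq0 : 0 ≤ q := by linarith [h.le_q]
  have hq1 : q ≤ 1 := by linarith [h.q_le]
  have hy0 := h.pow_nonneg k
  have hy1 := h.pow_le_half
  have hky := h.eight_mul_size_mul_pow_le
  have hny := h.mul_pow_le
  have hkn := h.ten_mul_size_le
  have hw : q ^ (2 * k - i) = q ^ k * q ^ (k - i) := by
    rw [← pow_add]; congr 1; omega
  have hx0 := h.pow_nonneg (k - i)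
  have hx1 : q ^ (k - i) ≤ 1 := pow_le_one₀ hq0 hq1
  have ht0 : 0 < (Real.log n ^ 2)⁻¹ := by positivity
  have ht1 : (Real.log n ^ 2)⁻¹ ≤ 1 := inv_le_one_of_one_le₀ (by nlinarith)
  have htny : (Real.log n ^ 2)⁻¹ * (n * q ^ k) ≤ 2 := by
    rw [inv_mul_le_iff₀ (by positivity)]
    linarith
  generalize (Real.log n ^ 2)⁻¹ = t at ht0 ht1 htny ⊢
  rw [hw]
  generalize q ^ (k - i) = x at hx0 hx1 ⊢
  generalize q ^ k = y at hy0 hy1 hky htny ⊢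
  have hg0 : 0 ≤ 2 * y - y * x := by nlinarith
  have hg2 : 2 * y - y * x ≤ 2 * y := by nlinarith
  refine (one_sub_pow_le_exp (by nlinarith) _).trans ?_
  rw [← Real.exp_nat_mul, ← Real.exp_add, ← Real.exp_add]
  gcongr
  rw [Nat.cast_sub (by omega)]
  push_cast
  set g := 2 * y - y * x with hg
  have h1 : ((n : ℝ) - 2 * k) * ((1 - t) * g) =
      n * g - 2 * (k * g) - t * (n * g) + 2 * (t * (k * g)) := by ring
  have h2 : k * g ≤ k * (2 * y) := by gcongr
  have h3 : t * (n * g) ≤ t * (n * (2 * y)) := by gcongr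
  have h4 : 0 ≤ t * (k * g) := by positivity
  have h5 : n * g = 2 * (n * y) - n * y * x := by rw [hg]; ring
  rw [h1, h5] at *
  linarith

lemma pairBound_le (h : NearThreshold n k q) :
    pairBound n k q (Real.log n ^ 2)⁻¹ ≤ 300000 * Real.log n ^ 11 / n := by
  have hn := h.size_pos
  have hL := h.le_log
  have hC := h.choose_mul_exp_le
  have hq0 : 0 ≤ q := by linarith [h.le_q]
  have hterm : ∀ i ∈ Finset.Ico 1 k, (n.choose k : ℝ) * ((k.choose i * n.choose (k - i) : ℕ) : ℝ) *
      ((((Real.log n ^ 2)⁻¹) ^ 4)⁻¹ * (1 - (1 - (Real.log n ^ 2)⁻¹) *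
        (2 * q ^ k - q ^ (2 * k - i))) ^ (n - 2 * k)) ≤ 150000 * Real.log n ^ 10 / n := by
    intro i hi
    rw [Finset.mem_Ico] at hi
    have h1 := h.pair_factor_le hi.2
    have h2 : ((k.choose i * n.choose (k - i) : ℕ) : ℝ) *
        Real.exp (-(n * q ^ k) + n * q ^ k * q ^ (k - i)) ≤ 168 * Real.log n ^ 2 / n := by
      by_cases hik : 4 * i ≤ 3 * k
      · exact h.choose_mul_choose_le_of_small hi.1 hik
      · refine (h.choose_mul_choose_le_of_large hi.2 (by omega)).trans ?_
        gcongr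
        nlinarith
    have h3 : (((Real.log n ^ 2)⁻¹) ^ 4)⁻¹ = Real.log n ^ 8 := by
      rw [inv_pow, inv_inv]; ring
    rw [h3]
    calc _ ≤ (n.choose k : ℝ) * ((k.choose i * n.choose (k - i) : ℕ) : ℝ) *
        (Real.log n ^ 8 * (Real.exp (-(n * q ^ k)) *
          Real.exp (-(n * q ^ k) + n * q ^ k * q ^ (k - i)) * Real.exp 3 ^ 2)) := by gcongr
      _ = (n.choose k * Real.exp (-(n * q ^ k))) * Real.exp 3 ^ 2 * Real.log n ^ 8 *
          (((k.choose i * n.choose (k - i) : ℕ) : ℝ) *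
            Real.exp (-(n * q ^ k) + n * q ^ k * q ^ (k - i))) := by ring
      _ ≤ 2 * 21 ^ 2 * Real.log n ^ 8 * (168 * Real.log n ^ 2 / n) := by
          gcongr
          exact exp_three_le
      _ = 148176 * (Real.log n ^ 10 / n) := by ring
      _ ≤ 150000 * (Real.log n ^ 10 / n) := by gcongr; norm_num
      _ = _ := by ring
  unfold pairBound
  refine (Finset.sum_le_card_nsmul _ _ _ hterm).trans ?_
  rw [Nat.card_Ico, nsmul_eq_mul]
  have hk : ((k - 1 : ℕ) : ℝ) ≤ 2 * Real.log n :=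
    le_trans (by exact_mod_cast Nat.sub_le k 1) h.size_le
  calc ((k - 1 : ℕ) : ℝ) * (150000 * Real.log n ^ 10 / n)
      ≤ 2 * Real.log n * (150000 * Real.log n ^ 10 / n) := by gcongr
    _ = _ := by ring

end NearThreshold

end PairEstimate

/-! ### Reducing failure of the swaps to the exceptional events. -/

section SwapFailure

variable {V : Type*} [Fintype V] [DecidableEq V]

lemma real_unique_and_not_swapsTo_le (p : I) {k s : ℕ} (hk : 1 ≤ k) (hV : 3 ≤ Fintype.card V)
    (U : Finset V) {s₀ : ℝ} (hs : U.card + s₀ + 1 ≤ s) :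
    G(V, p).real {G | HasUniqueDomSet G k ∧ ¬ SwapsTo U G fun G' => ¬ HasDomSet G' k} ≤
      G(V, p).real {G | ∃ T ∈ nearDomSets G k 2, ¬ Disjoint T U} +
      (G(V, p).real {G | ∃ S ∈ domSets G k, Disjoint S U ∧
        ∃ u ∈ S, ∀ v ∉ U, ¬ IsPrivateNeighbor G S u v} +
      (G(V, p).real {G | ¬ PatternsOccur s G} +
        G(V, p).real {G | s₀ ≤ (nearVertices G k).card})) := by
  refine le_trans (real_mono fun G hG => ?_) ((real_or_le p _ _).trans (add_le_add_right
    ((real_or_le p _ _).trans (add_le_add_right (real_or_le p _ _) _)) _))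
  by_contra hcon
  simp only [not_or] at hcon
  obtain ⟨h1, h2, h3, h4⟩ := hcon
  obtain ⟨⟨S, hS, huniq⟩, hswap⟩ := hG
  have hSU : Disjoint S U := by
    by_contra hd
    exact h1 ⟨S, mem_nearDomSets_of_le (by omega) (mem_domSets_iff.1 hS), hd⟩
  obtain ⟨u, hu⟩ := Finset.card_pos.1 (show 0 < S.card by rw [hS.1]; omega)
  obtain ⟨v, hvU, hv⟩ : ∃ v, v ∉ U ∧ IsPrivateNeighbor G S u v := by
    by_contra! hno
    exact h2 ⟨S, hS, hSU, u, hu, hno⟩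
  refine hswap (swapsTo_not_hasDomSet hS huniq hSU hu hvU hv.1 hv.2.1 hv.2.2 (s := s) ?_
    (not_not.1 h3) hV)
  have h5 : (U.card : ℝ) + (nearVertices G k).card + 1 ≤ s := by linarith [not_le.1 h4]
  exact_mod_cast h5

lemma real_not_hasDomSet_and_not_swapsTo_le (p : I) {k s : ℕ} (hk : 2 ≤ k)
    (U : Finset V) {s₀ : ℝ} (hs : U.card + s₀ + 1 ≤ s) :
    G(V, p).real {G | ¬ HasDomSet G k ∧ ¬ SwapsTo U G fun G' => HasUniqueDomSet G' k} ≤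
      G(V, p).real {G | ∃ T ∈ nearDomSets G k 2, ¬ Disjoint T U} +
      (G(V, p).real {G | ∃ T : Finset V, T.card = k ∧ ∃ z ∈ U, undominated G T = {z}} +
      (G(V, p).real {G | ∃ T ∈ nearDomSets G k 2, ∃ T' ∈ nearDomSets G k 2, T ≠ T' ∧
        ¬ Disjoint T T'} +
      (G(V, p).real {G | nearDomSets G k 1 = ∅} +
      (G(V, p).real {G | ¬ PatternsOccur s G} +
        G(V, p).real {G | s₀ ≤ (nearVertices G k).card})))) := by
  refine le_trans (real_mono fun G hG => ?_) ((real_or_le p _ _).trans (add_le_add_right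
    ((real_or_le p _ _).trans (add_le_add_right ((real_or_le p _ _).trans (add_le_add_right
      ((real_or_le p _ _).trans (add_le_add_right (real_or_le p _ _) _)) _)) _)) _))
  by_contra hcon
  simp only [not_or] at hcon
  obtain ⟨h1, h2, h3, h4, h5, h6⟩ := hcon
  obtain ⟨T₀, hT₀⟩ := Finset.nonempty_iff_ne_empty.2 h4
  have hT₀2 := mem_nearDomSets_of_le (s := 2) (by omega) hT₀
  rw [mem_nearDomSets] at hT₀
  have hcard : (undominated G T₀).card = 1 := by
    refine le_antisymm hT₀.2 (Finset.card_pos.2 (Finset.nonempty_iff_ne_empty.2 fun h => ?_))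
    exact hG.1 ⟨T₀, hT₀.1, isDominatingSet_iff.2 h⟩
  obtain ⟨z, hz⟩ := Finset.card_eq_one.1 hcard
  refine hG.2 (swapsTo_hasUniqueDomSet hk hG.1 hT₀.1 hz (fun hzU => h2 ⟨T₀, hT₀.1, z, hzU, hz⟩)
    ?_ (fun T hT T' hT' hne => ?_) (s := s) ?_ (not_not.1 h5))
  · by_contra hd
    exact h1 ⟨T₀, hT₀2, hd⟩
  · by_contra hd
    exact h3 ⟨T, hT, T', hT', hne, hd⟩
  · have h7 : (U.card : ℝ) + (nearVertices G k).card + 1 ≤ s := by linarith [not_le.1 h6]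
    exact_mod_cast h7

end SwapFailure

/-! ### Asymptotics of the error terms and existence of the edge probabilities. -/

section Limits

lemma tendsto_log_pow_div_rpow (a : ℕ) {b : ℝ} (hb : 0 < b) :
    Tendsto (fun n : ℕ => Real.log n ^ a / (n : ℝ) ^ b) atTop (𝓝 0) := by
  have h := (isLittleO_log_rpow_rpow_atTop (a : ℝ) hb).tendsto_div_nhds_zero.comp
    (tendsto_natCast_atTop_atTop (R := ℝ))
  refine h.congr fun n => ?_
  simp [Function.comp_apply, Real.rpow_natCast]

lemma tendsto_log_pow_div (a : ℕ) : Tendsto (fun n : ℕ => Real.log n ^ a / n) atTop (𝓝 0) := by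
  simpa using tendsto_log_pow_div_rpow a one_pos

lemma tendsto_rpow_mul_log_pow_div (a : ℕ) {c : ℝ} (hc : c < 1) :
    Tendsto (fun n : ℕ => (n : ℝ) ^ c * (Real.log n ^ a / n)) atTop (𝓝 0) := by
  refine (tendsto_log_pow_div_rpow a (sub_pos.2 hc)).congr' ?_
  filter_upwards [eventually_ge_atTop 1] with n hn
  have hn0 : (0 : ℝ) < n := by exact_mod_cast hn
  rw [Real.rpow_sub hn0, Real.rpow_one]
  field_simp

lemma eventually_rpow_add_sqrt_le {c : ℝ} (hc : c < 1) :
    ∀ᶠ n : ℕ in atTop, (n : ℝ) ^ c + √n + 1 ≤ (n / 4096 : ℕ) := by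
  have h1 := (tendsto_rpow_mul_log_pow_div 0 hc).eventually_le_const
    (show (0 : ℝ) < 1 / 16384 by norm_num)
  have h2 := (tendsto_rpow_mul_log_pow_div 0 (show (1 / 2 : ℝ) < 1 by norm_num)).eventually_le_const
    (show (0 : ℝ) < 1 / 16384 by norm_num)
  filter_upwards [h1, h2, eventually_ge_atTop 32768] with n h1 h2 h3
  have h3' : (32768 : ℝ) ≤ n := by exact_mod_cast h3
  have hn0 : (0 : ℝ) < n := by linarith
  rw [pow_zero, mul_one_div, div_le_iff₀ hn0] at h1 h2
  rw [← Real.sqrt_eq_rpow] at h2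
  have h4 : (n : ℝ) ≤ 4096 * ((n / 4096 : ℕ) : ℝ) + 4096 := by
    exact_mod_cast (by omega : n ≤ 4096 * (n / 4096) + 4096)
  linarith

/-- Each pattern has probability at least (1/8)³ = 1/512. With tilt 1/2 the exponent is -n/1024,
which dominates the +n/4096 due to the threshold s = n/4096 and the cubic number of triples. -/
lemma tendsto_patterns_bound : Tendsto (fun n : ℕ => (n.choose 3 : ℝ) *
    (8 * (((1 / 2 : ℝ) ^ (n / 4096))⁻¹ * (1 - (1 - 1 / 2) * (1 / 8) ^ 3) ^ (n - 3))))
    atTop (𝓝 0) := by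
  have h1 : Tendsto (fun n : ℕ => (n : ℝ) / 2048) atTop atTop :=
    tendsto_natCast_atTop_atTop.atTop_div_const (by norm_num)
  have h2 := ((Real.tendsto_pow_mul_exp_neg_atTop_nhds_zero 3).comp h1).const_mul (16 * 2048 ^ 3)
  rw [mul_zero] at h2
  refine squeeze_zero' (Eventually.of_forall fun n => by positivity) ?_ h2
  filter_upwards [eventually_ge_atTop 3] with n hn
  have e1 : (n.choose 3 : ℝ) ≤ (n : ℝ) ^ 3 := by exact_mod_cast Nat.choose_le_pow n 3
  have e2 : ((1 / 2 : ℝ) ^ (n / 4096))⁻¹ ≤ Real.exp (n / 4096) := by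
    rw [one_div, inv_pow, inv_inv]
    calc (2 : ℝ) ^ (n / 4096) ≤ Real.exp 1 ^ (n / 4096) := by
          have := Real.exp_one_gt_d9
          gcongr
          linarith
      _ = Real.exp ((n / 4096 : ℕ)) := by rw [← Real.exp_nat_mul, mul_one]
      _ ≤ _ := by
          gcongr
          exact Nat.cast_div_le
  have e3 : (1 - (1 - 1 / 2) * (1 / 8 : ℝ) ^ 3) ^ (n - 3) ≤
      Real.exp (-(n / 1024)) * 2 := by
    refine (one_sub_pow_le_exp (by norm_num) _).trans ?_
    have h4 : (2 : ℝ) ≥ Real.exp (3 / 1024) := by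
      have h5 : Real.exp (3 / 1024) ≤ Real.exp (Real.log 2) := by
        gcongr
        linarith [Real.log_two_gt_d9]
      rwa [Real.exp_log (by norm_num)] at h5
    calc Real.exp (-(((n - 3 : ℕ) : ℝ) * ((1 - 1 / 2) * (1 / 8) ^ 3)))
        = Real.exp (-(n / 1024)) * Real.exp (3 / 1024) := by
          rw [← Real.exp_add, Nat.cast_sub hn]
          congr 1
          push_cast
          ring
      _ ≤ _ := by gcongr
  have e4 : Real.exp ((n : ℝ) / 4096) * Real.exp (-(n / 1024)) ≤ Real.exp (-(n / 2048)) := by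
    rw [← Real.exp_add]
    gcongr
    have : (0 : ℝ) ≤ n := Nat.cast_nonneg n
    linarith
  calc (n.choose 3 : ℝ) *
      (8 * (((1 / 2 : ℝ) ^ (n / 4096))⁻¹ * (1 - (1 - 1 / 2) * (1 / 8) ^ 3) ^ (n - 3)))
      ≤ (n : ℝ) ^ 3 * (8 * (Real.exp (n / 4096) * (Real.exp (-(n / 1024)) * 2))) := by
        gcongr
    _ = 16 * n ^ 3 * (Real.exp (n / 4096) * Real.exp (-(n / 1024))) := by ring
    _ ≤ 16 * n ^ 3 * Real.exp (-(n / 2048)) := by gcongr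
    _ = _ := by simp only [Function.comp_apply]; ring

/-- Intermediate value theorem: the expectation is continuous in p, vanishes at p = 0 and is C(n,k)
≥ 1 at p = 1. -/
lemma exists_expectedDomSets_eq {n k : ℕ} (hk : 1 ≤ k) (hkn : k < n) {δ : ℝ} (hδ0 : 0 < δ)
    (hδ1 : δ < 1) : ∃ p : I, expectedDomSets n k p = δ := by
  have hcont : Continuous fun p : I => expectedDomSets n k p := by
    simp only [expectedDomSets_eq]
    fun_prop
  refine mem_range_of_exists_le_of_exists_ge hcont ⟨0, ?_⟩ ⟨1, ?_⟩
  · rw [expectedDomSets_eq]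
    simp only [Set.Icc.coe_zero, sub_zero, one_pow, sub_self]
    rw [zero_pow (by omega), mul_zero]
    exact hδ0.le
  · rw [expectedDomSets_eq]
    simp only [Set.Icc.coe_one, sub_self]
    rw [zero_pow (by omega), sub_zero, one_pow, mul_one]
    have : (1 : ℝ) ≤ n.choose k := by exact_mod_cast Nat.choose_pos hkn.le
    linarith

lemma exists_tendsto_expectedDomSets {δ : ℝ} (hδ0 : 0 < δ) (hδ1 : δ < 1) {k : ℕ → ℕ}
    (hk : ∀ n : ℕ, 1 ≤ n → |(k n : ℝ) - Real.log n| < 1) :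
    ∃ p : ℕ → I, Tendsto (fun n => expectedDomSets n (k n) (p n)) atTop (𝓝 δ) := by
  classical
  refine ⟨fun n => if h : ∃ p : I, expectedDomSets n (k n) p = δ then h.choose else 0, ?_⟩
  refine tendsto_const_nhds.congr' ?_
  have h1 := (tendsto_log_pow_div 1).eventually_le_const (show (0 : ℝ) < 1 / 2 by norm_num)
  filter_upwards [h1, tendsto_log_natCast.eventually_ge_atTop 2, eventually_ge_atTop 1]
    with n h1 h2 h3
  have hn0 : (0 : ℝ) < n := by exact_mod_cast h3
  rw [pow_one, div_le_iff₀ hn0] at h1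
  have h4 := abs_lt.1 (hk n h3)
  have h5 : 1 ≤ k n := by
    have : (1 : ℝ) < k n := by linarith [h4.1]
    exact_mod_cast this.le
  have h6 : k n < n := by
    have : (k n : ℝ) < n := by linarith [h4.2]
    exact_mod_cast this
  have h := exists_expectedDomSets_eq h5 h6 hδ0 hδ1
  rw [dif_pos h]
  exact h.choose_spec.symm

end Limits

/-! ### Assembling the estimates and the main theorem. -/

section MainEstimates

variable {n k : ℕ} {p : I}

lemma NearThreshold.inv_log_sq_pos {q : ℝ} (h : NearThreshold n k q) :
    0 < (Real.log n ^ 2)⁻¹ := by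
  have := h.le_log
  positivity

lemma NearThreshold.inv_log_sq_le_one {q : ℝ} (h : NearThreshold n k q) :
    (Real.log n ^ 2)⁻¹ ≤ 1 := by
  have := h.le_log
  exact inv_le_one_of_one_le₀ (by nlinarith)

lemma NearThreshold.meets_bound {q c : ℝ} (h : NearThreshold n k q) {u : ℕ}
    (hu : (u : ℝ) ≤ (n : ℝ) ^ c) :
    (u : ℝ) * ((n - 1).choose (k - 1) * nearBound n k q (Real.log n ^ 2)⁻¹) ≤
      168 * ((n : ℝ) ^ c * (Real.log n ^ 5 / n)) := by
  have hn := h.size_pos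
  have hL := h.le_log
  calc _ ≤ (u : ℝ) * (168 * Real.log n ^ 5 / n) := by
        gcongr
        exact h.choose_pred_mul_nearBound_le
    _ ≤ (n : ℝ) ^ c * (168 * Real.log n ^ 5 / n) := by gcongr
    _ = _ := by ring

lemma NearThreshold.real_nearVertices_le (h : NearThreshold n k (1 - p)) :
    G(Fin n, p).real {G | √n ≤ (nearVertices G k).card} ≤
      252 * (Real.log n ^ 5 / (n : ℝ) ^ (1 / 2 : ℝ)) := by
  have hn := h.size_pos
  have hL := h.le_log
  have h1 := real_card_nearVertices_ge_le (V := Fin n) p (k := k) h.inv_log_sq_pos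
    h.inv_log_sq_le_one (Real.sqrt_pos.2 hn)
  rw [Fintype.card_fin] at h1
  refine h1.trans ?_
  rw [← Real.sqrt_eq_rpow]
  calc _ ≤ (3 * Real.log n) * (84 * Real.log n ^ 4) / √n := by
        have h2 := h.size_le
        have h3 := h.choose_mul_nearBound_le
        have h4 : (k : ℝ) + 2 ≤ 3 * Real.log n := by linarith
        have h5 : 0 ≤ nearBound n k (1 - p) (Real.log n ^ 2)⁻¹ :=
          nearBound_nonneg p n k h.inv_log_sq_pos
        gcongr
    _ = _ := by ring

lemma NearThreshold.real_singleton_meets_le (h : NearThreshold n k (1 - p)) {c : ℝ}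
    {U : Finset (Fin n)} (hU : (U.card : ℝ) ≤ (n : ℝ) ^ c) :
    G(Fin n, p).real {G | ∃ T : Finset (Fin n), T.card = k ∧ ∃ z ∈ U, undominated G T = {z}} ≤
      84 * ((n : ℝ) ^ c * (Real.log n ^ 2 / n)) := by
  have hn := h.size_pos
  have h1 := real_undominated_singleton_meets_le p k U
  rw [Fintype.card_fin] at h1
  refine h1.trans ?_
  calc _ ≤ (n : ℝ) ^ c * (84 * Real.log n ^ 2 / n) := by
        have h2 := h.choose_mul_singleton_le
        have h3 : 0 ≤ 1 - (1 - p : ℝ) ^ k := by linarith [h.pow_le_half]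
        have h4 := h.pow_nonneg k
        gcongr
    _ = _ := by ring

lemma NearThreshold.real_no_near_one_le (h : NearThreshold n k (1 - p)) {δ : ℝ} (hδ : 0 < δ)
    (hμ : δ / 2 ≤ expectedDomSets n k p) (hpair : pairBound n k (1 - p) (Real.log n ^ 2)⁻¹ ≤ 1)
    (hL : 8 ≤ δ * Real.log n) :
    G(Fin n, p).real {G | nearDomSets G k 1 = ∅} ≤
      16 / δ * (Real.log n)⁻¹ + 16 * (Real.log n ^ 3 / n) := by
  have hL14 := h.le_log
  rw [expectedDomSets_eq] at hμ
  have h1 := h.le_choose_mul_binomialCdf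
  set μ := (n.choose k : ℝ) * binomialCdf (n - k) ((1 - p : ℝ) ^ k) 1 with hμdef
  have h2 : δ * Real.log n / 8 ≤ μ := by
    refine le_trans ?_ h1
    calc δ * Real.log n / 8 ≤ δ / 2 * (Real.log n ^ 2 / 4) := by nlinarith
      _ ≤ _ := by gcongr
  have h3 : 1 ≤ μ := by linarith
  have h4 := _root_.real_no_near_one_le (V := Fin n) p h.inv_log_sq_pos h.inv_log_sq_le_one
    (lt_of_le_of_lt h.pow_le_half (by norm_num)) (by linarith : 0 < μ)
    (by rw [Fintype.card_fin])
  rw [Fintype.card_fin] at h4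
  refine h4.trans (add_le_add ?_ ?_)
  · calc _ ≤ (1 + μ) / μ ^ 2 := by gcongr
      _ ≤ 2 / μ := by
          rw [div_le_div_iff₀ (by positivity) (by positivity)]
          nlinarith
      _ ≤ 2 / (δ * Real.log n / 8) := by gcongr
      _ = _ := by field_simp; ring
  · have := h.inv_one_sub_pow_le
    calc _ ≤ 1 + 16 * Real.log n ^ 3 / n - 1 := by gcongr
      _ = _ := by ring

lemma NearThreshold.le_real_unique (h : NearThreshold n k (1 - p)) :
    expectedDomSets n k p - (pairBound n k (1 - p) (Real.log n ^ 2)⁻¹ +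
      expectedDomSets n k p ^ 2 * (1 + 16 * (Real.log n ^ 3 / n))) ≤
      G(Fin n, p).real {G | HasUniqueDomSet G k} := by
  have h1 := le_real_hasUniqueDomSet (V := Fin n) p (k := k) h.inv_log_sq_pos h.inv_log_sq_le_one
    (lt_of_le_of_lt h.pow_le_half (by norm_num)) rfl
  rw [Fintype.card_fin, ← expectedDomSets_eq] at h1
  refine le_trans ?_ h1
  have := h.inv_one_sub_pow_le
  rw [mul_div_assoc] at this
  gcongr

lemma eventually_estimates {δ : ℝ} (hδ0 : 0 < δ) (hδ1 : δ < 1) {k : ℕ → ℕ}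
    (hk : ∀ n : ℕ, 1 ≤ n → |(k n : ℝ) - Real.log n| < 1) {p : ℕ → I}
    (hμ : Tendsto (fun n => expectedDomSets n (k n) (p n)) atTop (𝓝 δ)) {c : ℝ} (hc : c < 1)
    {ε : ℝ} (hε : 0 < ε) :
    ∀ᶠ n : ℕ in atTop, NearThreshold n (k n) (1 - p n) ∧
      3 / 4 * (δ * (1 - δ)) ≤ G(Fin n, p n).real {G | HasUniqueDomSet G (k n)} ∧
      3 / 4 * (δ * (1 - δ)) ≤ 1 - G(Fin n, p n).real {G | HasDomSet G (k n)} ∧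
      ∀ U : Finset (Fin n), (U.card : ℝ) ≤ (n : ℝ) ^ c →
        (U.card : ℝ) * ((n - 1).choose (k n - 1) *
          nearBound n (k n) (1 - p n) (Real.log n ^ 2)⁻¹) ≤ ε ∧
        G(Fin n, p n).real {G | HasUniqueDomSet G (k n) ∧
          ¬ SwapsTo U G fun G' => ¬ HasDomSet G' (k n)} ≤ 6 * ε ∧
        G(Fin n, p n).real {G | ¬ HasDomSet G (k n) ∧
          ¬ SwapsTo U G fun G' => HasUniqueDomSet G' (k n)} ≤ 6 * ε := by
  have hδδ : 0 < δ * (1 - δ) := mul_pos hδ0 (by linarith)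
  have hpair : Tendsto (fun n : ℕ => 300000 * (Real.log n ^ 11 / n)) atTop (𝓝 0) := by
    simpa using (tendsto_log_pow_div 11).const_mul 300000
  have hcube : Tendsto (fun n : ℕ => 16 * (Real.log n ^ 3 / n)) atTop (𝓝 0) := by
    simpa using (tendsto_log_pow_div 3).const_mul 16
  have hinv : Tendsto (fun n : ℕ => 16 / δ * (Real.log n)⁻¹) atTop (𝓝 0) := by
    simpa using (tendsto_inv_atTop_zero.comp tendsto_log_natCast).const_mul (16 / δ)
  have hone : Tendsto (fun n : ℕ => 16 / δ * (Real.log n)⁻¹ + 16 * (Real.log n ^ 3 / n)) atTop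
      (𝓝 0) := by simpa using hinv.add hcube
  have hmeet : Tendsto (fun n : ℕ => 168 * ((n : ℝ) ^ c * (Real.log n ^ 5 / n))) atTop (𝓝 0) := by
    simpa using (tendsto_rpow_mul_log_pow_div 5 hc).const_mul 168
  have hsing : Tendsto (fun n : ℕ => 84 * ((n : ℝ) ^ c * (Real.log n ^ 2 / n))) atTop (𝓝 0) := by
    simpa using (tendsto_rpow_mul_log_pow_div 2 hc).const_mul 84
  have hverts : Tendsto (fun n : ℕ => 252 * (Real.log n ^ 5 / (n : ℝ) ^ (1 / 2 : ℝ))) atTop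
      (𝓝 0) := by
    simpa using (tendsto_log_pow_div_rpow 5 (show (0 : ℝ) < 1 / 2 by norm_num)).const_mul 252
  have hpriv : Tendsto (fun n : ℕ => 84 * (Real.log n ^ 1 / n)) atTop (𝓝 0) := by
    simpa using (tendsto_log_pow_div 1).const_mul 84
  -- The limit is δ - δ² = δ(1-δ). The factor 3/4 in the conclusion leaves room for convergence.
  have huniq : Tendsto (fun n : ℕ => expectedDomSets n (k n) (p n) -
      (300000 * (Real.log n ^ 11 / n) + expectedDomSets n (k n) (p n) ^ 2 *
        (1 + 16 * (Real.log n ^ 3 / n)))) atTop (𝓝 (δ * (1 - δ))) := by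
    have h1 := hμ.sub (hpair.add ((hμ.pow 2).mul (hcube.const_add 1)))
    refine h1.trans (le_of_eq ?_)
    congr 1
    ring
  have hnone : Tendsto (fun n : ℕ => 1 - expectedDomSets n (k n) (p n)) atTop (𝓝 (1 - δ)) :=
    hμ.const_sub 1
  filter_upwards [eventually_nearThreshold hδ0 hδ1 hk hμ,
    hpair.eventually_le_const hε, hpair.eventually_le_const one_pos,
    hone.eventually_le_const hε, hmeet.eventually_le_const hε, hsing.eventually_le_const hε,
    hsing.eventually_le_const (show (0 : ℝ) < 42 by norm_num),
    hverts.eventually_le_const hε, hpriv.eventually_le_const hε,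
    tendsto_patterns_bound.eventually_le_const hε,
    huniq.eventually_const_le (show 3 / 4 * (δ * (1 - δ)) < δ * (1 - δ) by linarith),
    hnone.eventually_const_le (show 3 / 4 * (δ * (1 - δ)) < 1 - δ by nlinarith),
    hμ.eventually_const_le (show δ / 2 < δ by linarith),
    (tendsto_log_natCast.const_mul_atTop hδ0).eventually_ge_atTop 8,
    eventually_rpow_add_sqrt_le hc]
    with n h e1 e1' e2 e3 e4 e4' e5 e6 e7 e8 e9 e10 e11 e12
  have hn := h.size_pos
  have ht := h.inv_log_sq_pos
  have ht1 := h.inv_log_sq_le_one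
  have hP : pairBound n (k n) (1 - p n) (Real.log n ^ 2)⁻¹ ≤ 300000 * (Real.log n ^ 11 / n) := by
    have := h.pairBound_le
    rwa [mul_div_assoc] at this
  refine ⟨h, ?_, ?_, fun U hU => ?_⟩
  · refine (e8.trans ?_).trans h.le_real_unique
    gcongr
  · have := real_hasDomSet_le (V := Fin n) (p n) (k n)
    rw [Fintype.card_fin, ← expectedDomSets_eq] at this
    linarith
  have hs : (U.card : ℝ) + √n + 1 ≤ (n / 4096 : ℕ) := by linarith
  have hq := h.q_le
  have b1 := (h.meets_bound hU).trans e3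
  have b1' := real_near_meets_le (p n) (k := k n) ht ht1 U
  rw [Fintype.card_fin] at b1'
  replace b1' := b1'.trans b1
  have b2 := real_not_patternsOccur_le (V := Fin n) (p n) (n / 4096)
    (show (0 : ℝ) ≤ 1 / 8 by norm_num) (by linarith) h.le_q (show (0 : ℝ) < 1 / 2 by norm_num)
    (by norm_num)
  rw [Fintype.card_fin] at b2
  have b3 := h.real_nearVertices_le.trans e5
  have b4 := (h.real_singleton_meets_le hU).trans e4
  have b5 := real_near_intersect_le (V := Fin n) (p n) (k := k n) ht ht1
  rw [Fintype.card_fin] at b5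
  replace b5 := b5.trans (hP.trans e1)
  have b6 := (h.real_no_near_one_le hδ0 e10 (hP.trans e1') e11).trans e2
  -- The bound 42 on 84·n^c·L²/n was chosen to give exactly this.
  have hu : 2 * Real.log n ^ 2 * U.card ≤ n := by
    rw [← mul_div_assoc, ← mul_div_assoc, div_le_iff₀ hn] at e4'
    have : Real.log n ^ 2 * U.card ≤ Real.log n ^ 2 * (n : ℝ) ^ c := by gcongr
    linarith
  have b7 := real_no_private_neighbor_le (V := Fin n) (p n)
    (show 1 ≤ k n by have := h.le_size; omega) U
  rw [Fintype.card_fin] at b7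
  have b8 := b7.trans (h.choose_mul_no_private_le hu)
  rw [pow_one, ← mul_div_assoc] at e6
  have hk13 := h.le_size
  refine ⟨b1, ?_, ?_⟩
  · refine (real_unique_and_not_swapsTo_le (p n) (by omega) ?_ U hs).trans ?_
    · have := h.ten_mul_size_le
      rw [Fintype.card_fin]
      omega
    · linarith
  · refine (real_not_hasDomSet_and_not_swapsTo_le (p n) (by omega) U hs).trans ?_
    linarith

end MainEstimates

theorem theorem1 (δ : ℝ) (hδ0 : 0 < δ) (hδ1 : δ < 1) :
    ∃ ρ : ℝ, 0 < ρ ∧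
      ∀ k : ℕ → ℕ, (∀ n : ℕ, 1 ≤ n → |(k n : ℝ) - Real.log n| < 1) →
        -- the edge probabilities under consideration exist
        (∃ p : ℕ → I, Tendsto (fun n => expectedDomSets n (k n) (p n)) atTop (𝓝 δ)) ∧
        ∀ p : ℕ → I, Tendsto (fun n => expectedDomSets n (k n) (p n)) atTop (𝓝 δ) →
          ¬ DominationReducible k p ∧
          ∀ c : ℝ, 0 < c → c < 1 → ∀ ε : ℝ, 0 < ε →
            ∀ᶠ n : ℕ in atTop, ∀ U : Finset (Fin n), (U.card : ℝ) ≤ (n : ℝ) ^ c →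
              -- every decision based on the subgraph induced on `U` errs with probability `≥ ρ`
              (∀ f : SimpleGraph (U : Set (Fin n)) → Prop,
                ρ ≤ G(Fin n, p n).real
                  {G | ¬ (f (G.induce (U : Set (Fin n))) ↔ HasDomSet G (k n))}) ∧
              -- a symmetry mapping outside `U` destroys the unique dominating set
              ρ ≤ G(Fin n, p n).real
                {G | HasUniqueDomSet G (k n) ∧ SwapsTo U G (fun G' => ¬ HasDomSet G' (k n))} ∧
              -- a symmetry mapping outside `U` creates a unique dominating set
              ρ ≤ G(Fin n, p n).real
                {G | ¬ HasDomSet G (k n) ∧ SwapsTo U G (fun G' => HasUniqueDomSet G' (k n))} ∧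
              -- both fail with probability at most `ε` only
              G(Fin n, p n).real
                {G | HasUniqueDomSet G (k n) ∧
                  ¬ SwapsTo U G (fun G' => ¬ HasDomSet G' (k n))} ≤ ε ∧
              G(Fin n, p n).real
                {G | ¬ HasDomSet G (k n) ∧
                  ¬ SwapsTo U G (fun G' => HasUniqueDomSet G' (k n))} ≤ ε := by
  have hδδ : 0 < δ * (1 - δ) := mul_pos hδ0 (by linarith)
  refine ⟨δ * (1 - δ) / 2, by linarith, fun k hk =>
    ⟨exists_tendsto_expectedDomSets hδ0 hδ1 hk, fun p hμ => ?_⟩⟩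
  have main : ∀ c : ℝ, c < 1 → ∀ ε : ℝ, 0 < ε →
      ∀ᶠ n : ℕ in atTop, ∀ U : Finset (Fin n), (U.card : ℝ) ≤ (n : ℝ) ^ c →
        (∀ f : SimpleGraph (U : Set (Fin n)) → Prop, δ * (1 - δ) / 2 ≤ G(Fin n, p n).real
          {G | ¬ (f (G.induce (U : Set (Fin n))) ↔ HasDomSet G (k n))}) ∧
        δ * (1 - δ) / 2 ≤ G(Fin n, p n).real
          {G | HasUniqueDomSet G (k n) ∧ SwapsTo U G (fun G' => ¬ HasDomSet G' (k n))} ∧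
        δ * (1 - δ) / 2 ≤ G(Fin n, p n).real
          {G | ¬ HasDomSet G (k n) ∧ SwapsTo U G (fun G' => HasUniqueDomSet G' (k n))} ∧
        G(Fin n, p n).real {G | HasUniqueDomSet G (k n) ∧
          ¬ SwapsTo U G (fun G' => ¬ HasDomSet G' (k n))} ≤ ε ∧
        G(Fin n, p n).real {G | ¬ HasDomSet G (k n) ∧
          ¬ SwapsTo U G (fun G' => HasUniqueDomSet G' (k n))} ≤ ε := by
    intro c hc1 ε hε
    -- At most six exceptional events of probability at most this number occur, so each swap fails
    -- with probability at most min(ε, δ(1-δ)/4); subtracting from (3/4)δ(1-δ) leaves ρ = δ(1-δ)/2.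
    have hε' : 0 < min ε (δ * (1 - δ) / 4) / 6 := by positivity
    filter_upwards [eventually_estimates hδ0 hδ1 hk hμ hc1 hε'] with n hn U hU
    obtain ⟨h, h1, h2, h3⟩ := hn
    obtain ⟨h4, h5, h6⟩ := h3 U hU
    have h7 := min_le_left ε (δ * (1 - δ) / 4)
    have h8 := min_le_right ε (δ * (1 - δ) / 4)
    have hsplit : ∀ P Q : SimpleGraph (Fin n) → Prop, G(Fin n, p n).real {G | P G} ≤
        G(Fin n, p n).real {G | P G ∧ Q G} + G(Fin n, p n).real {G | P G ∧ ¬ Q G} := by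
      intro P Q
      refine (real_mono fun G hG => ?_).trans (real_or_le (p n) _ _)
      by_cases hQ : Q G
      · exact Or.inl ⟨hG, hQ⟩
      · exact Or.inr ⟨hG, hQ⟩
    refine ⟨fun f => ?_, ?_, ?_, by linarith, by linarith⟩
    · have h9 := le_real_decision_error (p n) h.inv_log_sq_pos h.inv_log_sq_le_one U f
        (β := min ε (δ * (1 - δ) / 4) / 6) (by rw [Fintype.card_fin]; exact h4) h1 h2
      refine le_trans ?_ h9
      linarith
    · have h9 := hsplit (fun G => HasUniqueDomSet G (k n))
        (fun G => SwapsTo U G fun G' => ¬ HasDomSet G' (k n))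
      linarith
    · have h9 := hsplit (fun G => ¬ HasDomSet G (k n))
        (fun G => SwapsTo U G fun G' => HasUniqueDomSet G' (k n))
      rw [real_not] at h9
      linarith
  refine ⟨?_, fun c _ hc1 ε hε => main c hc1 ε hε⟩
  rintro ⟨c, -, hc1, U, hU, hlim⟩
  have h1 := hlim.eventually_const_lt (show 1 - δ * (1 - δ) / 2 < 1 by linarith)
  obtain ⟨n, hn1, hn2⟩ := (h1.and (main c hc1 1 one_pos)).exists
  -- Reducibility is the special case in which the decision is whether the induced subgraph itself
  -- has a dominating set of size k; its error stays at least ρ.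
  have h2 := (hn2 (U n) (hU n)).1 fun H => HasDomSet H (k n)
  rw [real_not] at h2
  linarith
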